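/- Let $\mathcal P^2(\mathbb R^d)$ be the space of Borel probability measures on $\mathbb R^d$ with finite second moment, endowed with the second Wasserstein distance $W_2$. Let $U$ be a nonempty compact metric space and let $f:\mathbb R^d\times\mathcal P^2(\mathbb R^d)\times U\to\mathbb R^d$ be continuous and such that, for some $L>0$, $$\|f(x_1,m_1,u)-f(x_2,m_2,u)\|\le L\big(\|x_1-x_2\|+W_2(m_1,m_2)\big)$$ for all $x_1,x_2\in\mathbb R^d$, $m_1,m_2\in\mathcal P^2(\mathbb R^d)$, $u\in U$. Let $M\subset\mathcal P^2(\mathbb R^d)$ be closed and $G=\mathcal P^2(\mathbb R^d)\setminus M$. Write $L^2(m)=L^2(\mathbb R^d,m;\mathbb R^d)$, with inner product $\langle\cdot,\cdot\rangle_m$, and for $m\in\mathcal P^2(\mathbb R^d)$, $s\in L^2(m)$ put $$H(m,s)=\inf_{u\in U}\int_{\mathbb R^d}\langle s(x),f(x,m,u)\rangle\,m(dx).$$ Consider the Dirichlet problem $$H(m,D\varphi(m))+1-\varphi(m)=0\quad (m\in G),\qquad \varphi(m)=0\quad (m\in\partial G).\tag{D}$$ The subdifferential $\partial^-\psi(m)$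 of a real function $\psi$ defined near $m$ is the set of all $s\in L^2(m)$ such that, for every $F\in L^2(m)$, $$\psi\big((\mathrm{Id}+hF)\sharp m\big)-\psi(m)\ \ge\ h\langle s,F\rangle_m+o(h)\qquad(h\downarrow0);$$ the superdifferential $\partial^+\psi(m)$ is defined with $\le$ in place of $\ge$. In the Hadamard form of these notions, the condition is instead that, for every $F\in L^2(m)$, $$\langle s,F\rangle_m\ \le\ \liminf_{h\downarrow0,\ \|F'-F\|_{L^2(m)}=O(h)}\frac{\psi((\mathrm{Id}+hF')\sharp m)-\psi(m)}{h}$$ for the subdifferential, respectively $\langle s,F\rangle_m\ge\limsup$ of the same quotient for the superdifferential. A viscosity supersolution of (D) is a bounded lower semicontinuous $\varphi_1:\operatorname{cl}G\to\mathbb R$ with $\varphi_1=0$ on $\partial G$ and $H(m,s)+1-\varphi_1(m)\le0$ for all $m\in G$, $s\in\partial^-\varphi_1(m)$. A viscosity subsolution of (D) is a bounded upper semicontinuous $\varphi_2:\operatorname{cl}G\to\mathbb R$ with $\varphi_2=0$ on $\partial G$, continuous at every point of $\partial G$, and with $H(m,s)+1-\varphi_2(m)\ge0$ for all $m\in G$,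 $s\in\partial^+\varphi_2(m)$. A viscosity solution of (D) is a viscosity supersolution $\varphi$ for which there is a sequence of viscosity subsolutions $\varphi_k$ with $\varphi_k(m)\to\varphi(m)$ for every $m\in G$. **Theorem.** With either form of the sub- and superdifferentials (the same one throughout), the following hold. 1. (Comparison principle.) If $\varphi_1:\operatorname{cl}G\to[0,1]$ is a viscosity supersolution of (D) and $\varphi_2:\operatorname{cl}G\to[0,1]$ is a viscosity subsolution of (D), then $\varphi_2(m)\le\varphi_1(m)$ for every $m\in\operatorname{cl}G$. 2. (Uniqueness.) The Dirichlet problem (D) has at most one viscosity solution $\varphi:\operatorname{cl}G\to\mathbb R$. -/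

import Mathlib

open MeasureTheory Set Filter Topology
open scoped ENNReal

noncomputable section

namespace WassersteinHJ

/-- `ℝ^d` with the Euclidean norm. -/
abbrev E (d : ℕ) := EuclideanSpace ℝ (Fin d)

/-- `𝒫²(ℝ^d)`: Borel probability measures on `ℝ^d` with finite second moment. -/
@[ext]
structure P2 (d : ℕ) where
  toMeasure : Measure (E d)
  isProb : IsProbabilityMeasure toMeasure
  memLp_id : MemLp (fun x : E d => x) 2 toMeasure

instance P2.instIsProbabilityMeasure {d : ℕ} (m : P2 d) : IsProbabilityMeasure m.toMeasure :=
  m.isProb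

/-- `π` is a transport plan between `m₁` and `m₂`. -/
def IsPlan {d : ℕ} (m₁ m₂ : P2 d) (π : Measure (E d × E d)) : Prop :=
  π.map Prod.fst = m₁.toMeasure ∧ π.map Prod.snd = m₂.toMeasure

/-- The second Wasserstein distance. -/
def W2 {d : ℕ} (m₁ m₂ : P2 d) : ℝ :=
  Real.sqrt (⨅ (π : Measure (E d × E d)) (_ : IsPlan m₁ m₂ π),
    ∫⁻ z, edist z.1 z.2 ^ 2 ∂π).toReal

/-- The topology on `𝒫²(ℝ^d)` is that of the distance `W2`: a set is open iff it contains a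
`W2`-ball around each of its points. -/
instance P2.instTopologicalSpace (d : ℕ) : TopologicalSpace (P2 d) where
  IsOpen s := ∀ m ∈ s, ∃ r : ℝ, 0 < r ∧ ∀ m' : P2 d, W2 m m' < r → m' ∈ s
  isOpen_univ := fun _ _ => ⟨1, one_pos, fun _ _ => mem_univ _⟩
  isOpen_inter := by
    rintro s t hs ht m ⟨hms, hmt⟩
    obtain ⟨r₁, h₁, H₁⟩ := hs m hms
    obtain ⟨r₂, h₂, H₂⟩ := ht m hmt
    exact ⟨min r₁ r₂, lt_min h₁ h₂, fun m' hm' =>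
      ⟨H₁ m' (hm'.trans_le (min_le_left _ _)), H₂ m' (hm'.trans_le (min_le_right _ _))⟩⟩
  isOpen_sUnion := by
    rintro S hS m ⟨s, hsS, hms⟩
    obtain ⟨r, hr, H⟩ := hS s hsS m hms
    exact ⟨r, hr, fun m' hm' => ⟨s, hsS, H m' hm'⟩⟩

/-- The push-forward `(Id + h F) ♯ m`, for `F ∈ L²(m)`. -/
def P2.displace {d : ℕ} (m : P2 d) (F : E d → E d) (hF : MemLp F 2 m.toMeasure) (h : ℝ) :
    P2 d where
  toMeasure := m.toMeasure.map (fun x => x + h • F x)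
  isProb := Measure.isProbabilityMeasure_map
    (m.memLp_id.add (hF.const_smul h)).aestronglyMeasurable.aemeasurable
  memLp_id := by
    have hG : MemLp (fun x => x + h • F x) 2 m.toMeasure := m.memLp_id.add (hF.const_smul h)
    exact (memLp_map_measure_iff aestronglyMeasurable_id
      hG.aestronglyMeasurable.aemeasurable).2 hG

/-- The inner product `⟨s, F⟩_m` of `L²(m)`. -/
def pairing {d : ℕ} (m : P2 d) (s F : E d → E d) : ℝ :=
  ∫ x, inner ℝ (s x) (F x) ∂m.toMeasure

/-- The Hamiltonian `H(m, s) = inf_u ∫ ⟨s(x), f(x, m, u)⟩ m(dx)`. -/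
def hamiltonian {d : ℕ} {U : Type*} (f : E d → P2 d → U → E d) (m : P2 d) (s : E d → E d) : ℝ :=
  ⨅ u : U, pairing m s (fun x => f x m u)

/-- The two forms of sub- and superdifferentials: along the rays `h ↦ (Id + h F) ♯ m`, or
through Hadamard directional derivatives, where the direction may vary with `h`. -/
inductive DiffKind where
  | radial
  | hadamard

/-- The subdifferential `∂⁻ψ(m)`.
* `radial`: `ψ((Id + hF) ♯ m) - ψ(m) ≥ h ⟨s, F⟩_m + o(h)` as `h ↓ 0`, for every `F ∈ L²(m)`.
* `hadamard`: `⟨s, F⟩_m` is at most the lower limit of `(ψ((Id + hF') ♯ m) - ψ(m)) / h` as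
  `h ↓ 0` and `‖F' - F‖_{L²(m)} = O(h)`, for every `F ∈ L²(m)`. -/
def subdifferential {d : ℕ} (κ : DiffKind) (ψ : P2 d → ℝ) (m : P2 d) : Set (E d → E d) :=
  match κ with
  | .radial => {s | MemLp s 2 m.toMeasure ∧
      ∀ (F : E d → E d) (hF : MemLp F 2 m.toMeasure), ∀ ε : ℝ, 0 < ε →
        ∀ᶠ h : ℝ in 𝓝[>] 0,
          h * pairing m s F - ε * h ≤ ψ (m.displace F hF h) - ψ m}
  | .hadamard => {s | MemLp s 2 m.toMeasure ∧
      ∀ F : E d → E d, MemLp F 2 m.toMeasure → ∀ C : ℝ, ∀ ε : ℝ, 0 < ε →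
        ∀ᶠ h : ℝ in 𝓝[>] 0, ∀ (F' : E d → E d) (hF' : MemLp F' 2 m.toMeasure),
          eLpNorm (F' - F) 2 m.toMeasure ≤ ENNReal.ofReal (C * h) →
          h * pairing m s F - ε * h ≤ ψ (m.displace F' hF' h) - ψ m}

/-- The superdifferential `∂⁺ψ(m)`, with the inequalities of `subdifferential` reversed. -/
def superdifferential {d : ℕ} (κ : DiffKind) (ψ : P2 d → ℝ) (m : P2 d) : Set (E d → E d) :=
  match κ with
  | .radial => {s | MemLp s 2 m.toMeasure ∧
      ∀ (F : E d → E d) (hF : MemLp F 2 m.toMeasure), ∀ ε : ℝ, 0 < ε →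
        ∀ᶠ h : ℝ in 𝓝[>] 0,
          ψ (m.displace F hF h) - ψ m ≤ h * pairing m s F + ε * h}
  | .hadamard => {s | MemLp s 2 m.toMeasure ∧
      ∀ F : E d → E d, MemLp F 2 m.toMeasure → ∀ C : ℝ, ∀ ε : ℝ, 0 < ε →
        ∀ᶠ h : ℝ in 𝓝[>] 0, ∀ (F' : E d → E d) (hF' : MemLp F' 2 m.toMeasure),
          eLpNorm (F' - F) 2 m.toMeasure ≤ ENNReal.ofReal (C * h) →
          ψ (m.displace F' hF' h) - ψ m ≤ h * pairing m s F + ε * h}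

/-- Viscosity supersolutions of `H(m, Dφ(m)) + 1 - φ(m) = 0` in `G`, `φ = 0` on `∂G`.
A function on `cl G` is given by a function on the whole space of which only the values on
`cl G` matter: `G` is open in the applications, so the sub- and superdifferentials at points of
`G` do not depend on the values outside `G`. -/
structure IsViscositySupersolution {d : ℕ} {U : Type*} (κ : DiffKind)
    (f : E d → P2 d → U → E d) (G : Set (P2 d)) (φ : P2 d → ℝ) : Prop where
  bounded : ∃ C : ℝ, ∀ m ∈ closure G, |φ m| ≤ C
  lsc : LowerSemicontinuousOn φ (closure G)
  boundary : ∀ m ∈ frontier G, φ m = 0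
  ineq : ∀ m ∈ G, ∀ s ∈ subdifferential κ φ m, hamiltonian f m s + 1 - φ m ≤ 0

/-- Viscosity subsolutions of the Dirichlet problem; they are required to be continuous, as
functions on `cl G`, at the points of `∂G`. -/
structure IsViscositySubsolution {d : ℕ} {U : Type*} (κ : DiffKind)
    (f : E d → P2 d → U → E d) (G : Set (P2 d)) (φ : P2 d → ℝ) : Prop where
  bounded : ∃ C : ℝ, ∀ m ∈ closure G, |φ m| ≤ C
  usc : UpperSemicontinuousOn φ (closure G)
  boundary : ∀ m ∈ frontier G, φ m = 0
  continuous_boundary : ∀ m ∈ frontier G, ContinuousWithinAt φ (closure G) m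
  ineq : ∀ m ∈ G, ∀ s ∈ superdifferential κ φ m, 0 ≤ hamiltonian f m s + 1 - φ m

/-- Viscosity solutions of the Dirichlet problem: supersolutions that are, on `G`, pointwise
limits of a sequence of subsolutions. -/
structure IsViscositySolution {d : ℕ} {U : Type*} (κ : DiffKind)
    (f : E d → P2 d → U → E d) (G : Set (P2 d)) (φ : P2 d → ℝ) : Prop where
  supersolution : IsViscositySupersolution κ f G φ
  approx : ∃ φs : ℕ → P2 d → ℝ, (∀ k, IsViscositySubsolution κ f G (φs k)) ∧
    ∀ m ∈ G, Tendsto (fun k => φs k m) atTop (𝓝 (φ m))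

end WassersteinHJ

end

open WassersteinHJ

/-! ### A smooth variational principle in Hilbert spaces -/

/-! Comparison is proved after lifting to a Hilbert space of random variables. To compare at `m`,
take the probability space (ℝ^d, m) and consider X ↦ φ(law X) on its L² space, starting from the
identity. Only W₂(law X, law Y) ≤ ‖X − Y‖ is needed, never optimal plans. A proximal subgradient p
of the lift projects to a vector field in `subdifferential` of either kind, and the projection does
not change the Hamiltonian, because the velocity f(X, law X, u) is itself a function of X
(`mem_subdifferential_of_proximal`, `hamiltonian_law`). What remains is `proximal_comparison`, for a
Lipschitz control system x' = F(x,u) in a Hilbert space.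

Doubling variables meets two obstacles there: balls are not compact, so maxima need not exist, and
the boundary condition gives no uniform estimate near the boundary. The first is met by a
Borwein–Preiss type variational principle (`exists_touching_paraboloid`). For the second, a third
variable (t,k) is added, confined to the closure of the graph of points reached from x₀ by Euler
schemes. The penalty is θ log((η + |x−k|² + |x−y|²)/η) + δt. It bounds t, hence keeps k in a compact
set (`totallyBounded_eulerReach`), and keeps x and y close to k. Near a compact set the boundary
condition is uniform (`exists_uniform_separation`), so x avoids the boundary, while y avoids it
because supersolutions are nonnegative.

At the touching point the supersolution inequality selects a control u. The subsolution inequality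
holds for this u, and the reachable graph admits an Euler step with it. Adding the three
inequalities, the penalty gradients cancel up to 2Λθ, because the logarithm gives them weight θ/q
against a Lipschitz error of size Λq. Every error is a small multiple of the gap φ₂(x₀) − φ₁(x₀), a
contradiction.

Uniqueness follows by comparing each approximating subsolution of one solution with the other
solution and passing to the limit. -/

lemma exists_almost_max {α : Type*} {S : Set α} {γ : α → ℝ} (hγ : BddAbove (γ '' S)) {w : α}
    (hw : w ∈ S) {η : ℝ} (hη : 0 < η) :
    ∃ w' ∈ S, γ w ≤ γ w' ∧ ∀ z ∈ S, γ z ≤ γ w' + η := by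
  have hne : (γ '' S).Nonempty := ⟨_, mem_image_of_mem γ hw⟩
  obtain ⟨_, ⟨v, hv, rfl⟩, hlt⟩ := exists_lt_of_lt_csSup hne (sub_lt_self (sSup (γ '' S)) hη)
  have hsup : ∀ z ∈ S, γ z ≤ sSup (γ '' S) := fun z hz => le_csSup hγ (mem_image_of_mem γ hz)
  rcases le_total (γ w) (γ v) with h | h
  · exact ⟨v, hv, h, fun z hz => by linarith [hsup z hz]⟩
  · exact ⟨w, hw, le_rfl, fun z hz => by linarith [hsup z hz]⟩

/-- A sequence of almost maximizers of successively perturbed functions. -/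
lemma exists_perturbed_almost_max_seq {Z : Type*} [SeminormedAddCommGroup Z] {S : Set Z} {g : Z → ℝ}
    (hb : BddAbove (g '' S)) {z₀ : Z} (hz₀ : z₀ ∈ S) (c η : ℕ → ℝ) (hc : ∀ n, 0 ≤ c n)
    (hη : ∀ n, 0 < η n) :
    ∃ w : ℕ → Z, (∀ n, w n ∈ S) ∧
      (∀ n, g z₀ ≤ g (w n) - ∑ i ∈ Finset.range n, c i * ‖w n - w i‖ ^ 2) ∧
      (∀ n, ∀ z ∈ S, g z - ∑ i ∈ Finset.range n, c i * ‖z - w i‖ ^ 2 ≤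
        g (w n) - ∑ i ∈ Finset.range n, c i * ‖w n - w i‖ ^ 2 + η n) ∧
      (∀ n, c n * ‖w (n + 1) - w n‖ ^ 2 ≤ η n) := by
  classical
  -- The hypotheses are placed after the existential so that `choose` yields a total selection
  -- usable in the recursion.
  have key : ∀ (γ : Z → ℝ) (v : Z) (e : ℝ), ∃ v', BddAbove (γ '' S) → v ∈ S → 0 < e →
      v' ∈ S ∧ γ v ≤ γ v' ∧ ∀ z ∈ S, γ z ≤ γ v' + e := by
    intro γ v e
    by_cases h : BddAbove (γ '' S) ∧ v ∈ S ∧ 0 < e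
    · obtain ⟨v', h1, h2, h3⟩ := exists_almost_max h.1 h.2.1 h.2.2
      exact ⟨v', fun _ _ _ => ⟨h1, h2, h3⟩⟩
    · exact ⟨v, fun h1 h2 h3 => absurd ⟨h1, h2, h3⟩ h⟩
  choose nxt hnxt using key
  -- The state carries the current perturbed functional together with its almost maximizer. The new
  -- penalty vanishes at the old point, so the attained values never decrease.
  let step : ℕ → (Z → ℝ) × Z → (Z → ℝ) × Z := fun n p =>
    (fun z => p.1 z - c n * ‖z - p.2‖ ^ 2,
      nxt (fun z => p.1 z - c n * ‖z - p.2‖ ^ 2) p.2 (η (n + 1)))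
  let st : ℕ → (Z → ℝ) × Z := fun n => Nat.rec (g, nxt g z₀ (η 0)) step n
  have st1 : ∀ n, (st (n + 1)).1 = fun z => (st n).1 z - c n * ‖z - (st n).2‖ ^ 2 := fun _ => rfl
  have st2 : ∀ n, (st (n + 1)).2 = nxt (st (n + 1)).1 (st n).2 (η (n + 1)) := fun _ => rfl
  have hγ : ∀ n z, (st n).1 z = g z - ∑ i ∈ Finset.range n, c i * ‖z - (st i).2‖ ^ 2 := by
    intro n
    induction n with
    | zero => intro z; simp [st]
    | succ n ih => intro z; simp only [st1, Finset.sum_range_succ, ih]; ring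
  have hbdd : ∀ n, BddAbove ((st n).1 '' S) := by
    intro n
    obtain ⟨C, hC⟩ := hb
    refine ⟨C, ?_⟩
    rintro _ ⟨z, hz, rfl⟩
    rw [hγ]
    have : 0 ≤ ∑ i ∈ Finset.range n, c i * ‖z - (st i).2‖ ^ 2 :=
      Finset.sum_nonneg fun i _ => mul_nonneg (hc i) (sq_nonneg _)
    linarith [hC (mem_image_of_mem g hz)]
  have hmem : ∀ n, (st n).2 ∈ S := by
    intro n
    induction n with
    | zero => exact (hnxt g z₀ (η 0) hb hz₀ (hη 0)).1
    | succ n ih => rw [st2]; exact (hnxt _ _ _ (hbdd (n + 1)) ih (hη _)).1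
  have hmono : ∀ n, (st n).1 (st n).2 ≤ (st (n + 1)).1 (st (n + 1)).2 := by
    intro n
    have := (hnxt _ _ _ (hbdd (n + 1)) (hmem n) (hη (n + 1))).2.1
    rw [← st2] at this
    refine le_trans (le_of_eq ?_) this
    rw [st1]; simp
  have hmax : ∀ n, ∀ z ∈ S, (st n).1 z ≤ (st n).1 (st n).2 + η n := by
    intro n
    cases n with
    | zero => exact (hnxt g z₀ (η 0) hb hz₀ (hη 0)).2.2
    | succ n =>
      have := (hnxt _ _ _ (hbdd (n + 1)) (hmem n) (hη (n + 1))).2.2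
      rwa [← st2] at this
  refine ⟨fun n => (st n).2, hmem, ?_, ?_, ?_⟩
  · intro n
    rw [← hγ n (st n).2]
    induction n with
    | zero => exact (hnxt g z₀ (η 0) hb hz₀ (hη 0)).2.1
    | succ n ih => exact ih.trans (hmono n)
  · intro n z hz
    have := hmax n z hz
    rwa [hγ, hγ] at this
  · intro n
    have h1 := hmax n _ (hmem (n + 1))
    have h2 := hmono n
    rw [st1] at h2
    simp only at h2
    linarith

lemma norm_sub_sq_diff_le {V : Type*} [SeminormedAddCommGroup V] {a b w : V} {R : ℝ}
    (ha : ‖a - w‖ ≤ R) (hb : ‖b - w‖ ≤ R) :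
    ‖a - w‖ ^ 2 - ‖b - w‖ ^ 2 ≤ 2 * R * ‖a - b‖ := by
  have h1 : ‖a - w‖ - ‖b - w‖ ≤ ‖a - b‖ := by
    simpa using norm_sub_norm_le (a - w) (b - w)
  nlinarith [norm_nonneg (a - w), norm_nonneg (b - w), norm_nonneg (a - b)]

/-- A smooth variational principle: an upper semicontinuous function which is bounded above on a
closed subset of a Hilbert space admits points, no worse than a given one, at which it is touched
from above by a paraboloid with arbitrarily small slope. -/
theorem exists_touching_paraboloid {Z : Type*} [NormedAddCommGroup Z] [InnerProductSpace ℝ Z]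
    [CompleteSpace Z] {S : Set Z} (hS : IsClosed S) {g : Z → ℝ}
    (hg : UpperSemicontinuousOn g S) (hb : BddAbove (g '' S)) {z₀ : Z} (hz₀ : z₀ ∈ S) {μ : ℝ}
    (hμ : 0 < μ) :
    ∃ z ∈ S, g z₀ ≤ g z ∧ ∃ p : Z, ‖p‖ ≤ μ ∧ ∃ C : ℝ, 0 ≤ C ∧
      ∀ z' ∈ S, g z' ≤ g z + inner ℝ p (z' - z) + C * ‖z' - z‖ ^ 2 := by
  -- The ratio η n / c n = 4⁻ⁿ makes the steps at most 2⁻ⁿ, so the limit is within 2 of every `w n`.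
  -- Since ∑ c = μ/4, the slope ∑ 2 c i (z − w i) has norm at most 4 ∑ c = μ.
  set c : ℕ → ℝ := fun n => μ / 8 * (1 / 2) ^ n with hc_def
  set η : ℕ → ℝ := fun n => c n * ((1 / 2) ^ n) ^ 2 with hη_def
  have hc : ∀ n, 0 < c n := fun n => by positivity
  have hη : ∀ n, 0 < η n := fun n => mul_pos (hc n) (by positivity)
  obtain ⟨w, hwS, hw0, hwmax, hwstep⟩ :=
    exists_perturbed_almost_max_seq hb hz₀ c η (fun n => (hc n).le) hη
  have hdist : ∀ n, dist (w n) (w (n + 1)) ≤ 1 * (1 / 2) ^ n := by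
    intro n
    rw [dist_comm, dist_eq_norm, one_mul]
    have h1 : ‖w (n + 1) - w n‖ ^ 2 ≤ ((1 / 2) ^ n) ^ 2 :=
      le_of_mul_le_mul_left (hwstep n) (hc n)
    exact le_of_sq_le_sq h1 (by positivity)
  obtain ⟨z, hz⟩ := cauchySeq_tendsto_of_complete
    (cauchySeq_of_le_geometric (1 / 2) 1 (by norm_num) hdist)
  have hzS : z ∈ S := hS.mem_of_tendsto hz (Eventually.of_forall hwS)
  have hzw : ∀ n, ‖z - w n‖ ≤ 2 := by
    intro n
    have := dist_le_of_le_geometric_of_tendsto (1 / 2) 1 (by norm_num) hdist hz n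
    rw [dist_comm, dist_eq_norm] at this
    refine this.trans ?_
    have : ((1 : ℝ) / 2) ^ n ≤ 1 := pow_le_one₀ (by norm_num) (by norm_num)
    norm_num at this ⊢
    linarith
  have hcsum : HasSum c (μ / 4) := by
    have := (hasSum_geometric_two).mul_left (μ / 8)
    rwa [show μ / 8 * 2 = μ / 4 by ring] at this
  have hcfin : ∀ n, ∑ i ∈ Finset.range n, c i ≤ μ / 4 := fun n =>
    sum_le_hasSum _ (fun i _ => (hc i).le) hcsum
  have hpb : ∀ i, ‖(2 * c i) • (z - w i)‖ ≤ 4 * c i := by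
    intro i
    rw [norm_smul, Real.norm_of_nonneg (by linarith [hc i])]
    nlinarith [hzw i, hc i]
  have hpsum : Summable fun i => (2 * c i) • (z - w i) :=
    Summable.of_norm_bounded (hcsum.summable.mul_left 4) hpb
  set p : Z := ∑' i, (2 * c i) • (z - w i) with hp
  have husc : ∀ e > 0, ∀ᶠ n in atTop, g (w n) < g z + e := by
    intro e he
    have h1 := upperSemicontinuousOn_iff.1 hg z hzS (g z + e) (by linarith)
    exact (tendsto_nhdsWithin_iff.2 ⟨hz, Eventually.of_forall hwS⟩).eventually h1
  refine ⟨z, hzS, ?_, p, ?_, μ / 4, by positivity, ?_⟩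
  · refine le_of_forall_pos_le_add fun e he => ?_
    obtain ⟨n, hn⟩ := (husc e he).exists
    have : 0 ≤ ∑ i ∈ Finset.range n, c i * ‖w n - w i‖ ^ 2 :=
      Finset.sum_nonneg fun i _ => mul_nonneg (hc i).le (sq_nonneg _)
    linarith [hw0 n]
  · refine tsum_of_norm_bounded ?_ hpb
    have := hcsum.mul_left 4
    rwa [show 4 * (μ / 4) = μ by ring] at this
  · intro z' hz'
    refine le_of_forall_pos_le_add fun e he => ?_
    have hlim : Tendsto (fun n => g z + e + (inner ℝ (∑ i ∈ Finset.range n,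
        (2 * c i) • (z - w i)) (z' - z) + μ / 4 * ‖z' - z‖ ^ 2 + 2 * μ * ‖z - w n‖ + η n))
        atTop (𝓝 (g z + e + (inner ℝ p (z' - z) + μ / 4 * ‖z' - z‖ ^ 2 + 2 * μ * 0 + 0))) := by
      have h1 : Tendsto (fun n => ‖z - w n‖) atTop (𝓝 0) := by
        simpa using ((tendsto_const_nhds (x := z)).sub hz).norm
      have h2 : Tendsto η atTop (𝓝 0) := by
        have h3 : Tendsto (fun n : ℕ => ((1 : ℝ) / 2) ^ n) atTop (𝓝 0) :=
          tendsto_pow_atTop_nhds_zero_of_lt_one (by norm_num) (by norm_num)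
        have := (h3.const_mul (μ / 8)).mul (h3.pow 2)
        simpa [hη_def, hc_def] using this
      exact tendsto_const_nhds.add ((((hpsum.hasSum.tendsto_sum_nat.inner tendsto_const_nhds).add
        tendsto_const_nhds).add (h1.const_mul _)).add h2)
    have hev : ∀ᶠ n in atTop, g z' ≤ g z + e + (inner ℝ (∑ i ∈ Finset.range n,
        (2 * c i) • (z - w i)) (z' - z) + μ / 4 * ‖z' - z‖ ^ 2 + 2 * μ * ‖z - w n‖ + η n) := by
      filter_upwards [husc e he, hz.eventually (Metric.ball_mem_nhds z one_pos)] with n hn hn1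
      have hn1' : ‖z - w n‖ ≤ 1 := by
        rw [← dist_eq_norm, dist_comm]; exact (Metric.mem_ball.1 hn1).le
      have h1 := hwmax n z' hz'
      -- Expanding the squares about z is exact in an inner product space: the penalties become a
      -- linear term plus a paraboloid.
      have h2 : ∑ i ∈ Finset.range n, c i * ‖z' - w i‖ ^ 2 =
          ∑ i ∈ Finset.range n, c i * ‖z - w i‖ ^ 2 + inner ℝ (∑ i ∈ Finset.range n,
            (2 * c i) • (z - w i)) (z' - z) + (∑ i ∈ Finset.range n, c i) * ‖z' - z‖ ^ 2 := by
        rw [sum_inner, Finset.sum_mul, ← Finset.sum_add_distrib, ← Finset.sum_add_distrib]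
        refine Finset.sum_congr rfl fun i _ => ?_
        have : z' - w i = (z - w i) + (z' - z) := by abel
        rw [this, norm_add_sq_real, real_inner_smul_left]
        ring
      have h3 : ∑ i ∈ Finset.range n, c i * ‖z - w i‖ ^ 2 -
          ∑ i ∈ Finset.range n, c i * ‖w n - w i‖ ^ 2 ≤ 2 * μ * ‖z - w n‖ := by
        rw [← Finset.sum_sub_distrib]
        calc ∑ i ∈ Finset.range n, (c i * ‖z - w i‖ ^ 2 - c i * ‖w n - w i‖ ^ 2)
            ≤ ∑ i ∈ Finset.range n, c i * (2 * 3 * ‖z - w n‖) := by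
              refine Finset.sum_le_sum fun i _ => ?_
              rw [← mul_sub]
              refine mul_le_mul_of_nonneg_left (norm_sub_sq_diff_le ?_ ?_) (hc i).le
              · linarith [hzw i]
              · have : w n - w i = (z - w i) - (z - w n) := by abel
                rw [this]
                linarith [norm_sub_le (z - w i) (z - w n), hzw i]
          _ = (∑ i ∈ Finset.range n, c i) * (2 * 3 * ‖z - w n‖) := by rw [Finset.sum_mul]
          _ ≤ μ / 4 * (2 * 3 * ‖z - w n‖) := by gcongr; exact hcfin n
          _ ≤ _ := by nlinarith [norm_nonneg (z - w n)]
      have h4 : (∑ i ∈ Finset.range n, c i) * ‖z' - z‖ ^ 2 ≤ μ / 4 * ‖z' - z‖ ^ 2 := by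
        gcongr; exact hcfin n
      linarith
    have := ge_of_tendsto hlim hev
    linarith

/-! ### Compactness of the set of Euler points of a control system -/

/-- `EulerReach F x₀ t k`: the point `k` is reached from `x₀` at time `t` by an explicit Euler
scheme of arbitrary step sizes for the control system `x' = F x u`. -/
inductive EulerReach {H U : Type*} [AddCommGroup H] [Module ℝ H] (F : H → U → H) (x₀ : H) :
    ℝ → H → Prop
  | start : EulerReach F x₀ 0 x₀
  | step {t : ℝ} {k : H} (h : ℝ) (u : U) : EulerReach F x₀ t k → 0 ≤ h →
      EulerReach F x₀ (t + h) (k + h • F k u)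

section Euler

variable {H U : Type*} [NormedAddCommGroup H] [NormedSpace ℝ H] {F : H → U → H} {x₀ : H}

lemma EulerReach.time_nonneg {t : ℝ} {k : H} (hr : EulerReach F x₀ t k) : 0 ≤ t := by
  induction hr with
  | start => exact le_rfl
  | step h u _ hh ih => exact add_nonneg ih hh

/-- Compact sets which nearly contain the points reached by few steps of total length at most
`T`. -/
def eulerHull (F : H → U → H) (x₀ : H) (T : ℝ) : ℕ → Set H
  | 0 => {x₀}
  | j + 1 => (fun q : H × ℝ × H => q.1 + q.2.1 • q.2.2) ''
      (eulerHull F x₀ T j ×ˢ Icc (0 : ℝ) T ×ˢ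
        closure (convexHull ℝ ((fun q : H × U => F q.1 q.2) '' (eulerHull F x₀ T j ×ˢ univ))))

/-- By Mazur's theorem the closed convex hull of a compact set is compact in a complete space; the
rest is a continuous image of a product. -/
lemma isCompact_eulerHull [CompleteSpace H] [TopologicalSpace U] [CompactSpace U]
    (hF : Continuous fun q : H × U => F q.1 q.2) (T : ℝ) (j : ℕ) :
    IsCompact (eulerHull F x₀ T j) := by
  induction j with
  | zero => exact isCompact_singleton
  | succ j ih =>
    refine IsCompact.image (ih.prod (isCompact_Icc.prod ?_)) (by fun_prop)
    have htb := ((ih.prod isCompact_univ).image hF).totallyBounded.convexHull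
    exact htb.closure.isCompact_of_isClosed isClosed_closure

lemma add_mem_eulerHull {T s : ℝ} {j : ℕ} {a w : H} (ha : a ∈ eulerHull F x₀ T j)
    (hs : s ∈ Icc 0 T) (hw : w ∈ (fun v : H => s • v) '' convexHull ℝ (range (F a))) :
    a + w ∈ eulerHull F x₀ T (j + 1) := by
  obtain ⟨v, hv, rfl⟩ := hw
  refine ⟨(a, s, v), ⟨ha, hs, subset_closure (convexHull_mono ?_ hv)⟩, rfl⟩
  rintro _ ⟨u, rfl⟩
  exact ⟨(a, u), ⟨ha, mem_univ _⟩, rfl⟩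

/-- Convexity absorbs any number of steps with the field frozen at one point into a single
displacement. This is why the hull at each stage is convexified. -/
lemma add_mem_smul_convexHull {A : Set H} {s h : ℝ} (hs : 0 ≤ s) (hh : 0 ≤ h) {w v : H}
    (hw : w ∈ (fun v : H => s • v) '' convexHull ℝ A) (hv : v ∈ A) :
    w + h • v ∈ (fun v : H => (s + h) • v) '' convexHull ℝ A := by
  obtain ⟨w, hw, rfl⟩ := hw
  rcases eq_or_lt_of_le (add_nonneg hs hh) with h0 | h0
  · have hs0 : s = 0 := by linarith
    have hh0 : h = 0 := by linarith
    exact ⟨w, hw, by simp [hs0, hh0]⟩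
  · refine ⟨(s / (s + h)) • w + (h / (s + h)) • v, (convex_convexHull ℝ A) hw
      (subset_convexHull ℝ A hv) (by positivity) (by positivity) (by field_simp), ?_⟩
    simp only [smul_add, smul_smul]
    congr 2 <;> field_simp

/-- Every Euler point is close to a point of an Euler hull with a controlled number of steps. -/
lemma EulerReach.exists_anchor [Nonempty U] {Λ c₀ T τ : ℝ} (hΛ : 0 ≤ Λ) (hτ : 0 < τ)
    (hc₀ : 0 ≤ c₀) (hgrowth : ∀ x u, ‖F x u‖ ≤ c₀ + Λ * ‖x‖)
    (hlip : ∀ x y u, ‖F x u - F y u‖ ≤ Λ * ‖x - y‖) {t : ℝ} {k : H}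
    (hr : EulerReach F x₀ t k) (ht : t ≤ T) :
    ∃ (j : ℕ) (a : H) (s : ℝ) (w : H), a ∈ eulerHull F x₀ (2 * T) j ∧ 0 ≤ s ∧ s ≤ t ∧
      w ∈ (fun v : H => s • v) '' convexHull ℝ (range (F a)) ∧ j * τ + s ≤ 2 * t ∧
      c₀ + Λ * ‖a‖ ≤ (c₀ + Λ * ‖x₀‖) * Real.exp (Λ * (t - s)) ∧
      ‖k - (a + w)‖ + τ * ((c₀ + Λ * ‖x₀‖) * Real.exp (Λ * T)) ≤
        τ * ((c₀ + Λ * ‖x₀‖) * Real.exp (Λ * T)) * Real.exp (Λ * t) := by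
  set c₁ := c₀ + Λ * ‖x₀‖ with hc₁
  set B := c₁ * Real.exp (Λ * T) with hB
  have hc₁0 : 0 ≤ c₁ := by positivity
  have hB0 : 0 ≤ B := by positivity
  induction hr with
  | start =>
    refine ⟨0, x₀, 0, 0, mem_singleton _, le_rfl, le_rfl, ?_, by simp, by simp [hc₁], by simp⟩
    exact ⟨F x₀ (Classical.arbitrary U), subset_convexHull ℝ _ (mem_range_self _), by simp⟩
  | @step t k h u hr hh ih =>
    obtain ⟨j, a, s, w, ha, hs, hst, hw, hj, hca, he⟩ := ih (by linarith)
    have hwn : ‖w‖ ≤ s * (c₀ + Λ * ‖a‖) := by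
      obtain ⟨v, hv, rfl⟩ := hw
      have : ‖v‖ ≤ c₀ + Λ * ‖a‖ := by
        have hsub : convexHull ℝ (range (F a)) ⊆ Metric.closedBall 0 (c₀ + Λ * ‖a‖) := by
          refine convexHull_min ?_ (convex_closedBall _ _)
          rintro _ ⟨u, rfl⟩
          simpa using hgrowth a u
        simpa using hsub hv
      simp only [norm_smul, Real.norm_of_nonneg hs]
      gcongr
    have hexp1 : 1 + Λ * h ≤ Real.exp (Λ * h) := by
      linarith [Real.add_one_le_exp (Λ * h)]
    -- Discrete Gronwall step: shifted by τB, the error is multiplied by at most 1 + Λh ≤ exp(Λh).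
    have herr : ∀ e : ℝ, e ≤ ‖k - (a + w)‖ + h * (Λ * (‖k - (a + w)‖ + τ * B)) →
        e + τ * B ≤ τ * B * Real.exp (Λ * (t + h)) := by
      intro e hle
      rw [mul_add Λ, Real.exp_add, ← mul_assoc (τ * B)]
      calc e + τ * B ≤ (‖k - (a + w)‖ + τ * B) * (1 + Λ * h) := by linarith
        _ ≤ (τ * B * Real.exp (Λ * t)) * Real.exp (Λ * h) := by gcongr
    -- Steps are grouped into blocks with the field frozen at the anchor a. While a block has length
    -- at most τ, freezing costs Λ(error + τB). Otherwise a + w becomes the new anchor and the block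
    -- restarts with this one step, however long. Reanchoring requires s + h > τ, so it is paid for
    -- by the old block and the new step together; as a step may be charged twice, the count is
    -- bounded by 2t/τ independently of the number of Euler steps.
    by_cases hcase : s + h ≤ τ
    · refine ⟨j, a, s + h, w + h • F a u, ha, by linarith, by linarith,
        add_mem_smul_convexHull hs hh hw (mem_range_self _), by linarith, ?_, herr _ ?_⟩
      · rwa [add_sub_add_right_eq_sub]
      · have h1 : k + h • F k u - (a + (w + h • F a u)) =
            (k - (a + w)) + h • (F k u - F a u) := by
          rw [smul_sub]; abel
        have hwB : ‖w‖ ≤ τ * B := by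
          refine hwn.trans ?_
          have : c₀ + Λ * ‖a‖ ≤ B := by
            refine hca.trans ?_
            rw [hB]
            gcongr
            linarith
          gcongr
          linarith
        have h2 : ‖k - a‖ ≤ ‖k - (a + w)‖ + τ * B := by
          have : k - a = (k - (a + w)) + w := by abel
          rw [this]
          exact (norm_add_le _ _).trans (by linarith)
        rw [h1]
        refine (norm_add_le _ _).trans ?_
        rw [norm_smul, Real.norm_of_nonneg hh]
        gcongr
        exact (hlip k a u).trans (by gcongr)
    · refine ⟨j + 1, a + w, h, h • F (a + w) u, add_mem_eulerHull ha ⟨hs, ?_⟩ hw, hh, ?_,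
        ⟨_, subset_convexHull ℝ _ (mem_range_self u), rfl⟩, ?_, ?_, herr _ ?_⟩
      · have := hr.time_nonneg
        linarith
      · linarith [hr.time_nonneg]
      · push_cast
        linarith
      · have h1 : ‖a + w‖ ≤ ‖a‖ + s * (c₀ + Λ * ‖a‖) := (norm_add_le _ _).trans (by linarith)
        have h2 : 1 + Λ * s ≤ Real.exp (Λ * s) := by linarith [Real.add_one_le_exp (Λ * s)]
        calc c₀ + Λ * ‖a + w‖ ≤ c₀ + Λ * (‖a‖ + s * (c₀ + Λ * ‖a‖)) := by gcongr
          _ = (c₀ + Λ * ‖a‖) * (1 + Λ * s) := by ring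
          _ ≤ (c₁ * Real.exp (Λ * (t - s))) * Real.exp (Λ * s) := by gcongr
          _ = c₁ * Real.exp (Λ * (t + h - h)) := by
            rw [mul_assoc, ← Real.exp_add]; ring_nf
      · have h1 : k + h • F k u - (a + w + h • F (a + w) u) =
            (k - (a + w)) + h • (F k u - F (a + w) u) := by
          rw [smul_sub]; abel
        rw [h1]
        refine (norm_add_le _ _).trans ?_
        rw [norm_smul, Real.norm_of_nonneg hh]
        gcongr
        refine (hlip k (a + w) u).trans ?_
        gcongr
        have : 0 ≤ τ * B := by positivity
        linarith

/-- The points reached up to a finite time form a totally bounded set. -/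
theorem totallyBounded_eulerReach [CompleteSpace H] [TopologicalSpace U] [CompactSpace U]
    [Nonempty U] (hF : Continuous fun q : H × U => F q.1 q.2) {Λ : ℝ} (hΛ : 0 ≤ Λ)
    (hlip : ∀ x y u, ‖F x u - F y u‖ ≤ Λ * ‖x - y‖) (x₀ : H) (T : ℝ) :
    TotallyBounded {k | ∃ t ≤ T, EulerReach F x₀ t k} := by
  obtain ⟨c₀, hc₀⟩ : ∃ c₀, ∀ u, ‖F 0 u‖ ≤ c₀ := by
    have hcont : Continuous fun u => ‖F 0 u‖ := (hF.comp (by fun_prop : Continuous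
      fun u : U => ((0 : H), u))).norm
    obtain ⟨c₀, h⟩ := (isCompact_range hcont).bddAbove
    exact ⟨c₀, fun u => h (mem_range_self u)⟩
  have hc₀0 : 0 ≤ c₀ := (norm_nonneg _).trans (hc₀ (Classical.arbitrary U))
  have hgrowth : ∀ x u, ‖F x u‖ ≤ c₀ + Λ * ‖x‖ := by
    intro x u
    have h1 := hlip x 0 u
    have h2 : F x u = F 0 u + (F x u - F 0 u) := by abel
    rw [h2]
    refine (norm_add_le _ _).trans (add_le_add (hc₀ u) ?_)
    simpa using h1
  set B := (c₀ + Λ * ‖x₀‖) * Real.exp (Λ * T) with hB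
  have hB0 : 0 ≤ B := by positivity
  refine Metric.totallyBounded_iff.2 fun ε hε => ?_
  -- Small enough that the Gronwall error is at most ε/4; the +1 covers a vanishing field.
  set τ := ε / (4 * (B * Real.exp (Λ * T) + 1)) with hτ
  have hden : 0 < B * Real.exp (Λ * T) + 1 := by positivity
  have hτ0 : 0 < τ := by positivity
  have hτB : τ * B * Real.exp (Λ * T) ≤ ε / 4 := by
    have h1 : τ * (B * Real.exp (Λ * T) + 1) = ε / 4 := by
      rw [hτ]; field_simp
    nlinarith
  obtain ⟨N, hN⟩ := exists_nat_ge (2 * T / τ)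
  have hK : IsCompact (⋃ j ∈ Finset.range (N + 1), eulerHull F x₀ (2 * T) (j + 1)) :=
    (Finset.range (N + 1)).isCompact_biUnion fun j _ => isCompact_eulerHull hF _ _
  obtain ⟨Y, hYf, hY⟩ := Metric.totallyBounded_iff.1 hK.totallyBounded (ε / 2) (by positivity)
  refine ⟨Y, hYf, ?_⟩
  rintro k ⟨t, htT, hr⟩
  obtain ⟨j, a, s, w, ha, hs, hst, hw, hj, -, he⟩ :=
    hr.exists_anchor hΛ hτ0 hc₀0 hgrowth hlip htT
  have ht0 := hr.time_nonneg
  have haw : a + w ∈ eulerHull F x₀ (2 * T) (j + 1) := add_mem_eulerHull ha ⟨hs, by linarith⟩ hw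
  have hjN : j < N + 1 := by
    have h1 : (j : ℝ) ≤ 2 * T / τ := by
      rw [le_div_iff₀ hτ0]; linarith
    have : (j : ℝ) ≤ N := h1.trans hN
    have : j ≤ N := by exact_mod_cast this
    omega
  have hmem := hY (mem_biUnion (Finset.mem_coe.2 (Finset.mem_range.2 hjN)) haw)
  simp only [mem_iUnion, Metric.mem_ball, exists_prop] at hmem ⊢
  obtain ⟨y, hyY, hy⟩ := hmem
  refine ⟨y, hyY, ?_⟩
  have h1 : ‖k - (a + w)‖ ≤ ε / 4 := by
    have h2 : Real.exp (Λ * t) ≤ Real.exp (Λ * T) := by gcongr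
    have h3 : τ * B * Real.exp (Λ * t) ≤ τ * B * Real.exp (Λ * T) := by gcongr
    have h4 : 0 ≤ τ * B := by positivity
    linarith
  calc dist k y ≤ dist k (a + w) + dist (a + w) y := dist_triangle _ _ _
    _ < ε := by rw [dist_eq_norm]; linarith

/-- The closure of the graph of the reachability relation. -/
def eulerGraph (F : H → U → H) (x₀ : H) : Set (ℝ × H) :=
  closure {q | EulerReach F x₀ q.1 q.2}

lemma start_mem_eulerGraph : ((0 : ℝ), x₀) ∈ eulerGraph F x₀ :=
  subset_closure EulerReach.start

lemma time_nonneg_of_mem_eulerGraph {q : ℝ × H} (hq : q ∈ eulerGraph F x₀) : 0 ≤ q.1 := by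
  have hcl : IsClosed {q : ℝ × H | 0 ≤ q.1} := isClosed_le continuous_const continuous_fst
  exact closure_minimal (fun q hq => EulerReach.time_nonneg hq) hcl hq

/-- One-step stability passes to the closure by continuity. No trajectories are needed: this alone
yields the inequality satisfied by the variable k. -/
lemma step_mem_eulerGraph {u : U} (hF : Continuous fun x => F x u) {t h : ℝ} {k : H} (hh : 0 ≤ h)
    (hq : (t, k) ∈ eulerGraph F x₀) : (t + h, k + h • F k u) ∈ eulerGraph F x₀ := by
  have hc : Continuous fun q : ℝ × H => (q.1 + h, q.2 + h • F q.2 u) :=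
    (continuous_fst.add continuous_const).prodMk
      (continuous_snd.add ((hF.comp continuous_snd).const_smul h))
  exact map_mem_closure (f := fun q : ℝ × H => (q.1 + h, q.2 + h • F q.2 u)) hc hq
    fun q hq => EulerReach.step h u hq hh

lemma exists_isCompact_of_mem_eulerGraph [CompleteSpace H] [TopologicalSpace U] [CompactSpace U]
    [Nonempty U] (hF : Continuous fun q : H × U => F q.1 q.2) {Λ : ℝ} (hΛ : 0 ≤ Λ)
    (hlip : ∀ x y u, ‖F x u - F y u‖ ≤ Λ * ‖x - y‖) (x₀ : H) (T : ℝ) :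
    ∃ K : Set H, IsCompact K ∧ ∀ q ∈ eulerGraph F x₀, q.1 ≤ T → q.2 ∈ K := by
  -- A graph point with time at most T is a limit of reached points whose times may exceed T
  -- slightly, hence T + 1.
  have htb := totallyBounded_eulerReach hF hΛ hlip x₀ (T + 1)
  refine ⟨_, htb.closure.isCompact_of_isClosed isClosed_closure, fun q hq hqT => ?_⟩
  have hopen : IsOpen {q : ℝ × H | q.1 < T + 1} := isOpen_lt continuous_fst continuous_const
  have h1 : q ∈ closure ({q : ℝ × H | q.1 < T + 1} ∩ {q | EulerReach F x₀ q.1 q.2}) :=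
    hopen.inter_closure ⟨by change q.1 < T + 1; linarith, hq⟩
  exact map_mem_closure continuous_snd h1 fun q hq => ⟨q.1, hq.1.le, hq.2⟩

end Euler

/-! ### Comparison for proximal inequalities in a Hilbert space -/

/-- The smooth variational principle for functions of two points of a Hilbert space and a point
of a closed set of `ℝ × H`. -/
lemma exists_touching_paraboloid_prod {H : Type*} [NormedAddCommGroup H] [InnerProductSpace ℝ H]
    [CompleteSpace H] {S₁ S₂ : Set H} {R : Set (ℝ × H)} (h₁ : IsClosed S₁) (h₂ : IsClosed S₂)
    (hR : IsClosed R) {g : H × H × ℝ × H → ℝ} (hg : UpperSemicontinuousOn g (S₁ ×ˢ S₂ ×ˢ R))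
    (hb : BddAbove (g '' (S₁ ×ˢ S₂ ×ˢ R))) {q₀ : H × H × ℝ × H} (hq₀ : q₀ ∈ S₁ ×ˢ S₂ ×ˢ R)
    {μ : ℝ} (hμ : 0 < μ) :
    ∃ x ∈ S₁, ∃ y ∈ S₂, ∃ t k, (t, k) ∈ R ∧ g q₀ ≤ g (x, y, t, k) ∧
      ∃ (a b : H) (c : ℝ) (e : H) (C : ℝ), ‖a‖ ≤ μ ∧ ‖b‖ ≤ μ ∧ |c| ≤ μ ∧ ‖e‖ ≤ μ ∧ 0 ≤ C ∧
        ∀ x' ∈ S₁, ∀ y' ∈ S₂, ∀ t' k', (t', k') ∈ R → g (x', y', t', k') ≤ g (x, y, t, k) +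
          (inner ℝ a (x' - x) + inner ℝ b (y' - y) + c * (t' - t) + inner ℝ e (k' - k)) +
          C * (‖x' - x‖ ^ 2 + ‖y' - y‖ ^ 2 + (t' - t) ^ 2 + ‖k' - k‖ ^ 2) := by
  -- The ordinary product carries the sup norm; the nested `WithLp 2` supplies the Hilbert
  -- structure.
  let Z := WithLp 2 (WithLp 2 (H × H) × WithLp 2 (ℝ × H))
  let π : Z → H × H × ℝ × H := fun z => (z.fst.fst, z.fst.snd, z.snd.fst, z.snd.snd)
  let ι : H × H × ℝ × H → Z := fun q =>
    WithLp.toLp 2 (WithLp.toLp 2 (q.1, q.2.1), WithLp.toLp 2 (q.2.2.1, q.2.2.2))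
  have hπι : ∀ q, π (ι q) = q := fun q => rfl
  have hπ : Continuous π := by fun_prop
  have hS : IsClosed (π ⁻¹' (S₁ ×ˢ S₂ ×ˢ R)) := (h₁.prod (h₂.prod hR)).preimage hπ
  obtain ⟨z, hz, hgz, p, hp, C, hC, hmax⟩ := exists_touching_paraboloid hS
    (g := g ∘ π) (hg.comp hπ.continuousOn fun z hz => hz)
    (hb.mono (by rintro _ ⟨z, hz, rfl⟩; exact ⟨π z, hz, rfl⟩)) (z₀ := ι q₀)
    (by simpa [hπι] using hq₀) hμ
  have hnorm : ∀ v : Z, ‖v‖ ^ 2 =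
      ‖v.fst.fst‖ ^ 2 + ‖v.fst.snd‖ ^ 2 + v.snd.fst ^ 2 + ‖v.snd.snd‖ ^ 2 := by
    intro v
    rw [WithLp.prod_norm_sq_eq_of_L2, WithLp.prod_norm_sq_eq_of_L2, WithLp.prod_norm_sq_eq_of_L2,
      Real.norm_eq_abs, sq_abs]
    ring
  have hinner : ∀ v : Z, inner ℝ p v = inner ℝ p.fst.fst v.fst.fst + inner ℝ p.fst.snd v.fst.snd +
      p.snd.fst * v.snd.fst + inner ℝ p.snd.snd v.snd.snd := by
    intro v
    rw [WithLp.prod_inner_apply, WithLp.prod_inner_apply, WithLp.prod_inner_apply]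
    simp only [WithLp.ofLp_fst, WithLp.ofLp_snd, RCLike.inner_apply, conj_trivial]
    ring
  have hp2 : ‖p‖ ^ 2 ≤ μ ^ 2 := by gcongr
  rw [hnorm] at hp2
  have hs₁ := sq_nonneg ‖p.fst.fst‖
  have hs₂ := sq_nonneg ‖p.fst.snd‖
  have hs₃ := sq_nonneg p.snd.fst
  have hs₄ := sq_nonneg ‖p.snd.snd‖
  refine ⟨z.fst.fst, hz.1, z.fst.snd, hz.2.1, z.snd.fst, z.snd.snd, hz.2.2, hgz,
    p.fst.fst, p.fst.snd, p.snd.fst, p.snd.snd, C, ?_, ?_, ?_, ?_, hC, ?_⟩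
  · exact le_of_sq_le_sq (by linarith) hμ.le
  · exact le_of_sq_le_sq (by linarith) hμ.le
  · exact le_of_sq_le_sq (by rw [sq_abs]; linarith) hμ.le
  · exact le_of_sq_le_sq (by linarith) hμ.le
  · intro x' hx' y' hy' t' k' hq
    have h := hmax (ι (x', y', t', k')) ⟨hx', hy', hq⟩
    rw [hnorm, hinner] at h
    exact h

lemma log_le_log_add_div {q q' : ℝ} (hq : 0 < q) (hq' : 0 < q') :
    Real.log q' ≤ Real.log q + (q' - q) / q := by
  have h := Real.log_le_sub_one_of_pos (div_pos hq' hq)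
  rw [Real.log_div hq'.ne' hq.ne'] at h
  have : (q' - q) / q = q' / q - 1 := by field_simp
  linarith

/-- Divide by τ and let τ ↓ 0: the first-order condition at a one-sided constrained extremum. -/
lemma nonneg_of_forall_pos_mul_add_sq {A B : ℝ} (h : ∀ τ : ℝ, 0 < τ → 0 ≤ τ * A + τ ^ 2 * B) :
    0 ≤ A := by
  refine le_of_forall_pos_le_add fun e he => ?_
  have hτ : 0 < e / (|B| + 1) := by positivity
  have h1 := h _ hτ
  set τ := e / (|B| + 1)
  have h2 : 0 ≤ A + τ * B := by
    by_contra hneg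
    nlinarith
  have h3 : τ * (|B| + 1) = e := by simp only [τ]; field_simp
  nlinarith [le_abs_self B]

/-- Near a compact set, points of a closed set on which an upper semicontinuous function is
nonpositive are uniformly far from the points where that function is at least `σ > 0`. -/
lemma exists_uniform_separation {α : Type*} [MetricSpace α] {K B S : Set α} (hK : IsCompact K)
    (hB : IsClosed B) (hS : IsClosed S) {φ : α → ℝ} (hφ : UpperSemicontinuousOn φ S) {σ : ℝ}
    (hσ : 0 < σ) (hφB : ∀ x ∈ B, x ∈ S → φ x ≤ 0) :
    ∃ r : ℝ, 0 < r ∧ ∀ k ∈ K, ∀ x ∈ B, ∀ y ∈ S, dist x k < r → dist x y < r → φ y < σ := by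
  by_contra! hcon
  have hpos : ∀ n : ℕ, (0 : ℝ) < 1 / (n + 1) := fun n => by positivity
  choose k hk x hx y hy hxk hxy hφy using fun n : ℕ => hcon (1 / (n + 1)) (hpos n)
  obtain ⟨c, -, ψ, hψ, hlim⟩ := hK.tendsto_subseq hk
  have hsmall : Tendsto (fun n => 1 / ((ψ n : ℝ) + 1)) atTop (𝓝 0) :=
    tendsto_one_div_add_atTop_nhds_zero_nat.comp hψ.tendsto_atTop
  have hxlim : Tendsto (x ∘ ψ) atTop (𝓝 c) := by
    refine (tendsto_iff_of_dist ?_).1 hlim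
    exact squeeze_zero (fun _ => dist_nonneg)
      (fun n => by rw [dist_comm]; exact (hxk (ψ n)).le) hsmall
  have hylim : Tendsto (y ∘ ψ) atTop (𝓝 c) := by
    refine (tendsto_iff_of_dist ?_).1 hxlim
    exact squeeze_zero (fun _ => dist_nonneg) (fun n => (hxy (ψ n)).le) hsmall
  have hcB : c ∈ B := hB.mem_of_tendsto hxlim (Eventually.of_forall fun n => hx _)
  have hcS : c ∈ S := hS.mem_of_tendsto hylim (Eventually.of_forall fun n => hy _)
  have h1 := upperSemicontinuousOn_iff.1 hφ c hcS σ ((hφB c hcB hcS).trans_lt hσ)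
  have h2 := (tendsto_nhdsWithin_iff.2
    ⟨hylim, Eventually.of_forall fun n => hy (ψ n)⟩).eventually h1
  obtain ⟨n, hn⟩ := h2.exists
  exact absurd hn (not_lt.2 (hφy (ψ n)))

lemma exists_norm_bound_of_lipschitz {H U : Type*} [NormedAddCommGroup H]
    [TopologicalSpace U] [CompactSpace U] {F : H → U → H}
    (hF : Continuous fun q : H × U => F q.1 q.2) {Λ : ℝ} (hΛ : 0 ≤ Λ)
    (hlip : ∀ x y u, ‖F x u - F y u‖ ≤ Λ * ‖x - y‖) (ρ : ℝ) :
    ∃ b : ℝ, 0 ≤ b ∧ ∀ x u, ‖x‖ ≤ ρ → ‖F x u‖ ≤ b := by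
  have hcont : Continuous fun u => ‖F 0 u‖ := (hF.comp (by fun_prop : Continuous
    fun u : U => ((0 : H), u))).norm
  obtain ⟨c₀, h⟩ := (isCompact_range hcont).bddAbove
  refine ⟨max 0 (c₀ + Λ * ρ), le_max_left _ _, fun x u hx => le_max_of_le_right ?_⟩
  have h1 := hlip x 0 u
  have h2 : F x u = F 0 u + (F x u - F 0 u) := by abel
  rw [h2]
  refine (norm_add_le _ _).trans (add_le_add (h (mem_range_self u)) (h1.trans ?_))
  rw [sub_zero]
  gcongr

lemma inner_le_of_norm_le {H : Type*} [NormedAddCommGroup H] [InnerProductSpace ℝ H] {p v : H}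
    {μ b : ℝ} (hp : ‖p‖ ≤ μ) (hv : ‖v‖ ≤ b) : inner ℝ p v ≤ μ * b :=
  (real_inner_le_norm p v).trans (mul_le_mul hp hv (norm_nonneg _) ((norm_nonneg _).trans hp))

set_option maxHeartbeats 1000000 in
/-- Comparison of sub- and supersolutions, in the proximal sense, of
`inf_u ⟨Dφ, F x u⟩ + 1 - φ = 0` in a Hilbert space, for a control system which depends
Lipschitz continuously on the state and has a compact set of controls. -/
theorem proximal_comparison {H U : Type*} [NormedAddCommGroup H] [InnerProductSpace ℝ H]
    [CompleteSpace H] [TopologicalSpace U] [CompactSpace U] [Nonempty U] {F : H → U → H}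
    (hF : Continuous fun q : H × U => F q.1 q.2) {Λ : ℝ} (hΛ : 0 ≤ Λ)
    (hlip : ∀ x y u, ‖F x u - F y u‖ ≤ Λ * ‖x - y‖)
    {S₁ S₂ B₁ B₂ : Set H} (hS₁ : IsClosed S₁) (hS₂ : IsClosed S₂) (hB₁ : IsClosed B₁)
    {φ₁ φ₂ : H → ℝ} (hφ₁ : LowerSemicontinuousOn φ₁ S₁) (hφ₂ : UpperSemicontinuousOn φ₂ S₂)
    {C : ℝ} (hC₁ : ∀ x ∈ S₁, |φ₁ x| ≤ C) (hC₂ : ∀ x ∈ S₂, |φ₂ x| ≤ C)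
    (hbd₁ : ∀ x ∈ B₁, φ₁ x = 0) (hbd₂ : ∀ x ∈ B₁, x ∈ S₂ → φ₂ x ≤ 0)
    (hbd₃ : ∀ x ∈ S₁, ∀ y ∈ B₂, φ₂ y ≤ φ₁ x)
    (hsuper : ∀ x ∈ S₁, x ∉ B₁ → ∀ (p : H) (c : ℝ),
      (∀ x' ∈ S₁, φ₁ x + inner ℝ p (x' - x) - c * ‖x' - x‖ ^ 2 ≤ φ₁ x') →
      ∀ e > 0, ∃ u, inner ℝ p (F x u) + 1 - φ₁ x ≤ e)
    (hsub : ∀ y ∈ S₂, y ∉ B₂ → ∀ (p : H) (c : ℝ),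
      (∀ y' ∈ S₂, φ₂ y' ≤ φ₂ y + inner ℝ p (y' - y) + c * ‖y' - y‖ ^ 2) →
      ∀ u, 0 ≤ inner ℝ p (F y u) + 1 - φ₂ y)
    {x₀ : H} (hx₁ : x₀ ∈ S₁) (hx₂ : x₀ ∈ S₂) : φ₂ x₀ ≤ φ₁ x₀ := by
  by_contra! hlt
  set σ := φ₂ x₀ - φ₁ x₀ with hσ_def
  have hσ : 0 < σ := by linarith
  have hC : 0 ≤ C := (abs_nonneg _).trans (hC₁ x₀ hx₁)
  -- The final budget is δ + 2Λθ + μ(3b + 1) + σ/16 ≤ σ/8 + σ/8 + 3σ/16 + σ/16 = σ/2, less than the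
  -- gap σ.
  set δ := σ / 8 with hδ_def
  have hδ : 0 < δ := by positivity
  set θ := σ / (8 * (2 * Λ + 1)) with hθ_def
  have hθ : 0 < θ := by positivity
  have hθΛ : 2 * Λ * θ ≤ σ / 8 := by
    have : θ * (2 * Λ + 1) = σ / 8 := by rw [hθ_def]; field_simp
    nlinarith
  obtain ⟨K, hK, hKmem⟩ := exists_isCompact_of_mem_eulerGraph hF hΛ hlip x₀ (2 * C / δ)
  obtain ⟨r, hr, hsep⟩ := exists_uniform_separation hK hB₁ hS₂ hφ₂ hσ hbd₂
  obtain ⟨ρ, hρ⟩ := hK.isBounded.exists_norm_le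
  obtain ⟨b, hb, hFb⟩ := exists_norm_bound_of_lipschitz hF hΛ hlip (ρ + 2 * r)
  -- With this η, a penalty θ(log q − log η) of at most 2C forces q ≤ r².
  set η := r ^ 2 / Real.exp (2 * C / θ) with hη_def
  have hη : 0 < η := by positivity
  set μ := σ / (16 * (b + 1)) with hμ_def
  have hμ : 0 < μ := by positivity
  have hμb : μ * b + μ = σ / 16 := by rw [hμ_def]; field_simp
  let Q : H → H → H → ℝ := fun x y k => η + ‖x - k‖ ^ 2 + ‖x - y‖ ^ 2
  have hQ : ∀ x y k, η ≤ Q x y k := fun x y k => by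
    simp only [Q]; nlinarith [sq_nonneg ‖x - k‖, sq_nonneg ‖x - y‖]
  have hQpos : ∀ x y k, 0 < Q x y k := fun x y k => hη.trans_le (hQ x y k)
  let g : H × H × ℝ × H → ℝ := fun q =>
    φ₂ q.2.1 + (-φ₁ q.1 + -(θ * (Real.log (Q q.1 q.2.1 q.2.2.2) - Real.log η) + δ * q.2.2.1))
  have hgusc : UpperSemicontinuousOn g (S₁ ×ˢ S₂ ×ˢ eulerGraph F x₀) := by
    have hQc : Continuous fun q : H × H × ℝ × H => Q q.1 q.2.1 q.2.2.2 := by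
      simp only [Q]; fun_prop
    have hlog : Continuous fun q : H × H × ℝ × H => Real.log (Q q.1 q.2.1 q.2.2.2) :=
      hQc.log fun q => (hQpos _ _ _).ne'
    have hpen : Continuous fun q : H × H × ℝ × H =>
        -(θ * (Real.log (Q q.1 q.2.1 q.2.2.2) - Real.log η) + δ * q.2.2.1) := by fun_prop
    refine UpperSemicontinuousOn.add ?_ (UpperSemicontinuousOn.add ?_ ?_)
    · exact hφ₂.comp (g := fun q : H × H × ℝ × H => q.2.1) (by fun_prop) fun q hq => hq.2.1
    · have h := hφ₁.comp (g := fun q : H × H × ℝ × H => q.1)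
        (t := S₁ ×ˢ S₂ ×ˢ eulerGraph F x₀) (by fun_prop) fun q hq => hq.1
      exact h.neg
    · exact hpen.upperSemicontinuous.upperSemicontinuousOn _
  have hlogη : ∀ x y k, Real.log η ≤ Real.log (Q x y k) := fun x y k =>
    Real.log_le_log hη (hQ x y k)
  have hgb : BddAbove (g '' (S₁ ×ˢ S₂ ×ˢ eulerGraph F x₀)) := by
    refine ⟨2 * C, ?_⟩
    rintro _ ⟨⟨x, y, t, k⟩, ⟨hx, hy, htk⟩, rfl⟩
    have h1 := abs_le.1 (hC₁ x hx)
    have h2 := abs_le.1 (hC₂ y hy)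
    have h3 : 0 ≤ t := time_nonneg_of_mem_eulerGraph htk
    have h4 : 0 ≤ θ * (Real.log (Q x y k) - Real.log η) :=
      mul_nonneg hθ.le (sub_nonneg.2 (hlogη x y k))
    have h5 : 0 ≤ δ * t := by positivity
    simp only [g]
    linarith [h1.1, h2.2]
  obtain ⟨x, hx, y, hy, t, k, htk, hg0, a, b', c, e, C', ha, hb', hc, he, hC', hmax⟩ :=
    exists_touching_paraboloid_prod hS₁ hS₂ isClosed_closure hgusc hgb
      (q₀ := (x₀, x₀, 0, x₀)) ⟨hx₁, hx₂, start_mem_eulerGraph⟩ hμ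
  have ht : 0 ≤ t := time_nonneg_of_mem_eulerGraph htk
  set q := Q x y k with hq_def
  have hq : 0 < q := hQpos x y k
  have hval : σ + θ * (Real.log q - Real.log η) + δ * t ≤ φ₂ y - φ₁ x := by
    have : g (x₀, x₀, 0, x₀) = σ := by simp [g, Q, hσ_def, sub_eq_add_neg]
    rw [this] at hg0
    simp only [g] at hg0
    linarith
  have hx1 := abs_le.1 (hC₁ x hx)
  have hy1 := abs_le.1 (hC₂ y hy)
  have hδt : 0 ≤ δ * t := by positivity
  have hlogq : 0 ≤ θ * (Real.log q - Real.log η) :=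
    mul_nonneg hθ.le (sub_nonneg.2 (hlogη x y k))
  have hgap : σ ≤ φ₂ y - φ₁ x := by linarith
  have hkK : k ∈ K := by
    refine hKmem (t, k) htk ?_
    simp only
    rw [le_div_iff₀ hδ]
    linarith [hx1.1, hy1.2]
  have hqr : q ≤ r ^ 2 := by
    have h1 : Real.log q ≤ Real.log η + 2 * C / θ := by
      have : Real.log q - Real.log η ≤ 2 * C / θ := by
        rw [le_div_iff₀ hθ]
        linarith [hx1.1, hy1.2]
      linarith
    rw [Real.log_le_iff_le_exp hq, Real.exp_add, Real.exp_log hη, hη_def,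
      div_mul_cancel₀ _ (Real.exp_pos _).ne'] at h1
    exact h1
  have hqeq : q = η + ‖x - k‖ ^ 2 + ‖x - y‖ ^ 2 := rfl
  have hxk : ‖x - k‖ < r := lt_of_pow_lt_pow_left₀ 2 hr.le (by linarith [sq_nonneg ‖x - y‖])
  have hxy : ‖x - y‖ < r := lt_of_pow_lt_pow_left₀ 2 hr.le (by linarith [sq_nonneg ‖x - k‖])
  have hxB : x ∉ B₁ := fun hxB => by
    have h1 := hsep k hkK x hxB y hy (by rwa [dist_eq_norm]) (by rwa [dist_eq_norm])
    rw [hbd₁ x hxB] at hgap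
    linarith
  have hyB : y ∉ B₂ := fun hyB => by linarith [hbd₃ x hx y hyB]
  have hkn : ‖k‖ ≤ ρ := hρ k hkK
  have hxn : ‖x‖ ≤ ρ + r := by
    have : x = k + (x - k) := by abel
    rw [this]; exact (norm_add_le _ _).trans (by linarith)
  have hyn : ‖y‖ ≤ ρ + 2 * r := by
    have : y = x - (x - y) := by abel
    rw [this]; exact (norm_sub_le _ _).trans (by linarith)
  set w := θ / q with hw_def
  have hw : 0 < w := by positivity
  -- Concavity replaces the logarithm by its tangent, so the penalty is dominated by a quadratic
  -- touching at the same point, as the proximal tests require.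
  have hconc : ∀ x' y' k', θ * (Real.log (Q x' y' k') - Real.log η) ≤
      θ * (Real.log q - Real.log η) + w * (Q x' y' k' - q) := by
    intro x' y' k'
    have h1 := log_le_log_add_div hq (hQpos x' y' k')
    have h2 : w * (Q x' y' k' - q) = θ * ((Q x' y' k' - q) / q) := by rw [hw_def]; ring
    have h3 := mul_le_mul_of_nonneg_left h1 hθ.le
    rw [h2]
    linarith
  obtain ⟨u, hu⟩ := hsuper x hx hxB (-((2 * w) • ((x - k) + (x - y))) - a) (2 * w + C') (by
    intro x' hx'
    have h1 := hmax x' hx' y hy t k htk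
    have h2 := hconc x' y k
    have h3 : Q x' y k - q = 2 * inner ℝ ((x - k) + (x - y)) (x' - x) + 2 * ‖x' - x‖ ^ 2 := by
      have e1 : x' - k = (x - k) + (x' - x) := by abel
      have e2 : x' - y = (x - y) + (x' - x) := by abel
      simp only [hqeq, Q]
      rw [e1, e2, norm_add_sq_real (x - k), norm_add_sq_real (x - y), inner_add_left]
      ring
    rw [h3] at h2
    simp only [g, sub_self, inner_zero_right, norm_zero, mul_zero] at h1
    rw [inner_sub_left, inner_neg_left, real_inner_smul_left]
    linarith) (σ / 16) (by positivity)
  have hv := hsub y hy hyB ((2 * w) • (y - x) + b') (w + C') (by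
    intro y' hy'
    have h1 := hmax x hx y' hy' t k htk
    have h2 := hconc x y' k
    have h3 : Q x y' k - q = 2 * inner ℝ (y - x) (y' - y) + ‖y' - y‖ ^ 2 := by
      have e2 : y' - x = (y - x) + (y' - y) := by abel
      simp only [hqeq, Q]
      rw [norm_sub_rev x y', norm_sub_rev x y, e2, norm_add_sq_real (y - x)]
      ring
    rw [h3] at h2
    simp only [g, sub_self, inner_zero_right, norm_zero, mul_zero] at h1
    rw [inner_add_left, real_inner_smul_left]
    linarith) u
  have hFu : Continuous fun x => F x u :=
    hF.comp (by fun_prop : Continuous fun x : H => (x, u))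
  -- The pair (t,k) can only be varied inside the graph; the Euler step with the control u chosen at
  -- x is an admissible variation, giving a one-sided inequality.
  have hinv : 0 ≤ δ + 2 * w * inner ℝ (k - x) (F k u) + c + inner ℝ e (F k u) := by
    refine nonneg_of_forall_pos_mul_add_sq
      (B := w * ‖F k u‖ ^ 2 + C' * (1 + ‖F k u‖ ^ 2)) fun h hh => ?_
    have h1 := hmax x hx y hy (t + h) (k + h • F k u)
      (step_mem_eulerGraph hFu hh.le htk)
    have h2 := hconc x y (k + h • F k u)
    have h3 : Q x y (k + h • F k u) - q =
        2 * h * inner ℝ (k - x) (F k u) + h ^ 2 * ‖F k u‖ ^ 2 := by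
      have e2 : k + h • F k u - x = (k - x) + h • F k u := by abel
      simp only [hqeq, Q]
      rw [norm_sub_rev x (k + _), norm_sub_rev x k, e2, norm_add_sq_real (k - x), norm_smul,
        mul_pow, Real.norm_eq_abs, sq_abs, real_inner_smul_right]
      ring
    rw [h3] at h2
    simp only [g, sub_self, inner_zero_right, norm_zero, add_sub_cancel_left, norm_smul, mul_pow,
      Real.norm_eq_abs, sq_abs, real_inner_smul_right] at h1
    linarith
  have hFx := hFb x u (by linarith)
  have hFy := hFb y u hyn
  have hFk := hFb k u (by linarith)
  have i1 := inner_le_of_norm_le ha hFx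
  have i2 := inner_le_of_norm_le hb' hFy
  have i3 := inner_le_of_norm_le he hFk
  have i4 : c ≤ μ := (le_abs_self c).trans hc
  have j1 : inner ℝ (y - x) (F y u - F x u) ≤ Λ * ‖x - y‖ ^ 2 := by
    have := inner_le_of_norm_le (le_refl ‖y - x‖) (hlip y x u)
    rw [norm_sub_rev x y]; linarith
  have j2 : inner ℝ (x - k) (F x u - F k u) ≤ Λ * ‖x - k‖ ^ 2 := by
    have := inner_le_of_norm_le (le_refl ‖x - k‖) (hlip x k u)
    linarith
  -- Because w q = θ, the Lipschitz error is bounded independently of q; the penalty itself need not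
  -- tend to zero.
  have j3 : 2 * w * (inner ℝ (y - x) (F y u - F x u) + inner ℝ (x - k) (F x u - F k u)) ≤
      2 * Λ * θ := by
    have h1 : w * q = θ := by rw [hw_def]; field_simp
    calc _ ≤ 2 * w * (Λ * (‖x - y‖ ^ 2 + ‖x - k‖ ^ 2)) := by gcongr; linarith
      _ ≤ 2 * w * (Λ * q) := by gcongr; linarith
      _ = 2 * Λ * θ := by rw [← h1]; ring
  have j4 : inner ℝ (y - x) (F y u - F x u) + inner ℝ (x - k) (F x u - F k u) =
      inner ℝ (y - x) (F y u) + inner ℝ ((x - k) + (x - y)) (F x u) + inner ℝ (k - x) (F k u) := by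
    simp only [inner_sub_left, inner_sub_right, inner_add_left]
    ring
  rw [j4] at j3
  rw [inner_sub_left, inner_neg_left, real_inner_smul_left] at hu
  rw [inner_add_left, real_inner_smul_left] at hv
  linarith

/-! ### Lifting to a space of square integrable random variables -/

lemma lintegral_edist_sq_eq {d : ℕ} {Ω : Type*} [MeasurableSpace Ω] {μ : Measure Ω}
    (X Y : Lp (E d) 2 μ) :
    ∫⁻ ω, edist (X ω) (Y ω) ^ 2 ∂μ = ENNReal.ofReal (‖X - Y‖ ^ 2) := by
  have h1 : eLpNorm (⇑(X - Y)) 2 μ = ENNReal.ofReal ‖X - Y‖ := by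
    rw [Lp.norm_def, ENNReal.ofReal_toReal (Lp.eLpNorm_ne_top _)]
  have h2 := eLpNorm_nnreal_pow_eq_lintegral (f := ⇑(X - Y)) (μ := μ) (p := 2) two_ne_zero
  simp only [NNReal.coe_ofNat, ENNReal.rpow_ofNat, ENNReal.coe_ofNat] at h2
  rw [ENNReal.ofReal_pow (norm_nonneg _), ← h1, h2]
  refine lintegral_congr_ae ?_
  filter_upwards [Lp.coeFn_sub X Y] with ω hω
  rw [hω, Pi.sub_apply, edist_eq_enorm_sub]

section Lift

variable {d : ℕ} {Ω : Type*} [MeasurableSpace Ω] {μ : Measure Ω} [IsProbabilityMeasure μ]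

/-- The law of a square integrable random variable. -/
noncomputable def law (X : Lp (E d) 2 μ) : P2 d where
  toMeasure := μ.map X
  isProb := Measure.isProbabilityMeasure_map (Lp.aestronglyMeasurable X).aemeasurable
  memLp_id := (memLp_map_measure_iff aestronglyMeasurable_id
    (Lp.aestronglyMeasurable X).aemeasurable).2 (Lp.memLp X)

lemma measurePreserving_law (X : Lp (E d) 2 μ) : MeasurePreserving X μ (law X).toMeasure :=
  ⟨(Lp.stronglyMeasurable X).measurable, rfl⟩

/-- The joint law of X and Y is a competitor in the infimum. -/
lemma W2_law_le (X Y : Lp (E d) 2 μ) : W2 (law X) (law Y) ≤ ‖X - Y‖ := by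
  have hX := (Lp.stronglyMeasurable X).measurable
  have hY := (Lp.stronglyMeasurable Y).measurable
  have hplan : IsPlan (law X) (law Y) (μ.map fun ω => (X ω, Y ω)) := by
    constructor
    · rw [Measure.map_map measurable_fst (hX.prodMk hY)]; rfl
    · rw [Measure.map_map measurable_snd (hX.prodMk hY)]; rfl
  have hle : (⨅ (π : Measure (E d × E d)) (_ : IsPlan (law X) (law Y) π),
      ∫⁻ z, edist z.1 z.2 ^ 2 ∂π) ≤ ENNReal.ofReal (‖X - Y‖ ^ 2) := by
    refine (iInf₂_le _ hplan).trans (le_of_eq ?_)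
    rw [lintegral_map (by fun_prop) (hX.prodMk hY), lintegral_edist_sq_eq]
  unfold W2
  refine Real.sqrt_le_iff.2 ⟨norm_nonneg _, ?_⟩
  exact ENNReal.toReal_le_of_le_ofReal (sq_nonneg _) hle

lemma continuous_law : Continuous (law : Lp (E d) 2 μ → P2 d) := by
  refine continuous_def.2 fun s hs => Metric.isOpen_iff.2 fun X hX => ?_
  obtain ⟨r, hr, H⟩ := hs (law X) hX
  refine ⟨r, hr, fun Y hY => H (law Y) ((W2_law_le X Y).trans_lt ?_)⟩
  rwa [← dist_eq_norm, dist_comm]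

/-- The identity of `ℝ^d` as a random variable of law `m`. -/
noncomputable def WassersteinHJ.P2.idLp (m : P2 d) : Lp (E d) 2 m.toMeasure := m.memLp_id.toLp _

lemma law_idLp (m : P2 d) : law m.idLp = m := by
  ext1
  change m.toMeasure.map m.idLp = m.toMeasure
  rw [P2.idLp, Measure.map_congr m.memLp_id.coeFn_toLp]
  exact Measure.map_id

lemma W2_self (m : P2 d) : W2 m m = 0 := by
  have h := W2_law_le m.idLp m.idLp
  rw [law_idLp, sub_self, norm_zero] at h
  exact le_antisymm h (Real.sqrt_nonneg _)

/-- Composition of vector fields in `L²(law X)` with `X`. -/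
noncomputable def compLaw (X : Lp (E d) 2 μ) :
    Lp (E d) 2 (law X).toMeasure →ₗᵢ[ℝ] Lp (E d) 2 μ :=
  Lp.compMeasurePreservingₗᵢ ℝ X (measurePreserving_law X)

lemma coeFn_compLaw_toLp (X : Lp (E d) 2 μ) {F : E d → E d} (hF : MemLp F 2 (law X).toMeasure) :
    compLaw X (hF.toLp F) =ᵐ[μ] fun ω => F (X ω) := by
  have h : compLaw X (hF.toLp F) =
      (hF.comp_measurePreserving (measurePreserving_law X)).toLp (F ∘ X) := rfl
  rw [h]
  exact MemLp.coeFn_toLp _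

lemma law_add_smul_compLaw (X : Lp (E d) 2 μ) {F : E d → E d} (hF : MemLp F 2 (law X).toMeasure)
    (h : ℝ) : law (X + h • compLaw X (hF.toLp F)) = (law X).displace F hF h := by
  ext1
  change μ.map (X + h • compLaw X (hF.toLp F) : Lp (E d) 2 μ) =
    (μ.map X).map (fun x => x + h • F x)
  have hF' : AEMeasurable (fun x => x + h • F x) (μ.map X) :=
    ((law X).memLp_id.add (hF.const_smul h)).aestronglyMeasurable.aemeasurable
  rw [AEMeasurable.map_map_of_aemeasurable hF' (Lp.aestronglyMeasurable X).aemeasurable]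
  refine Measure.map_congr ?_
  filter_upwards [Lp.coeFn_add X (h • compLaw X (hF.toLp F)),
    Lp.coeFn_smul h (compLaw X (hF.toLp F)), coeFn_compLaw_toLp X hF] with ω h1 h2 h3
  rw [h1, Pi.add_apply, h2, Pi.smul_apply, h3]
  rfl

/-- The projection of a random variable to a vector field, given by conditional expectation with
respect to `X`. -/
lemma exists_field_of_lp (X p : Lp (E d) 2 μ) :
    ∃ s : E d → E d, MemLp s 2 (law X).toMeasure ∧
      ∀ (F : E d → E d) (hF : MemLp F 2 (law X).toMeasure),
        pairing (law X) s F = inner ℝ p (compLaw X (hF.toLp F)) := by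
  let T := (compLaw X).toContinuousLinearMap
  refine ⟨T.adjoint p, Lp.memLp _, fun F hF => ?_⟩
  have h : inner ℝ p (T (hF.toLp F)) = inner ℝ (T.adjoint p) (hF.toLp F) :=
    (T.adjoint_inner_left _ _).symm
  change _ = inner ℝ p (T (hF.toLp F))
  rw [h, L2.inner_def]
  refine integral_congr_ae ?_
  filter_upwards [hF.coeFn_toLp] with x hx
  rw [hx]

/-- Taking C = 0 and F' = F recovers the ray, so it suffices to produce Hadamard subgradients. -/
lemma subdifferential_hadamard_subset (κ : DiffKind) (ψ : P2 d → ℝ) (m : P2 d) :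
    subdifferential .hadamard ψ m ⊆ subdifferential κ ψ m := by
  cases κ with
  | hadamard => exact subset_rfl
  | radial =>
    rintro s ⟨hs, H⟩
    refine ⟨hs, fun F hF ε hε => ?_⟩
    filter_upwards [H F hF 0 ε hε] with h hh
    exact hh F hF (by simp)

lemma mem_superdifferential_of_neg {κ : DiffKind} {ψ : P2 d → ℝ} {m : P2 d} {s : E d → E d}
    (hs : -s ∈ subdifferential κ (fun m => -ψ m) m) : s ∈ superdifferential κ ψ m := by
  have hneg : ∀ F, pairing m (-s) F = -pairing m s F := fun F => by
    simp [pairing, integral_neg]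
  cases κ with
  | radial =>
    obtain ⟨hmem, H⟩ := hs
    refine ⟨by simpa using hmem.neg, fun F hF ε hε => ?_⟩
    filter_upwards [H F hF ε hε] with h hh
    rw [hneg] at hh
    linarith
  | hadamard =>
    obtain ⟨hmem, H⟩ := hs
    refine ⟨by simpa using hmem.neg, fun F hF C ε hε => ?_⟩
    filter_upwards [H F hF C ε hε] with h hh F' hF' hle
    have := hh F' hF' hle
    rw [hneg] at this
    linarith

/-- A proximal subgradient of the lift of `ψ` gives an element of the subdifferential of `ψ`. -/
lemma mem_subdifferential_of_proximal (κ : DiffKind) {ψ : P2 d → ℝ} {X p : Lp (E d) 2 μ}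
    {c r : ℝ} (hr : 0 < r) (hψ : ∀ X' : Lp (E d) 2 μ, ‖X' - X‖ < r →
      ψ (law X) + inner ℝ p (X' - X) - c * ‖X' - X‖ ^ 2 ≤ ψ (law X'))
    {s : E d → E d} (hs : MemLp s 2 (law X).toMeasure)
    (hpair : ∀ (F : E d → E d) (hF : MemLp F 2 (law X).toMeasure),
      pairing (law X) s F = inner ℝ p (compLaw X (hF.toLp F))) :
    s ∈ subdifferential κ ψ (law X) := by
  refine subdifferential_hadamard_subset κ ψ (law X) ⟨hs, fun F hF C ε hε => ?_⟩
  set D := ‖hF.toLp F‖ + |C| with hD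
  have hD0 : 0 ≤ D := by positivity
  -- Coefficient of h²: the deviation of F' from F costs ‖p‖|C|h², the paraboloid |c|D²h². Both are
  -- absorbed in εh for small h.
  set A := ‖p‖ * |C| + |c| * D ^ 2 with hA
  have hlim : ∀ a : ℝ, Tendsto (fun h : ℝ => h * a) (𝓝[>] 0) (𝓝 0) := fun a => by
    have : Tendsto (fun h : ℝ => h * a) (𝓝 0) (𝓝 (0 * a)) := tendsto_id.mul_const a
    rw [zero_mul] at this
    exact this.mono_left nhdsWithin_le_nhds
  filter_upwards [(hlim D).eventually_lt_const hr, (hlim A).eventually_lt_const hε,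
    (hlim 1).eventually_lt_const one_pos, self_mem_nhdsWithin] with h h1 h2 h3 h0 F' hF' hle
  have hpos : 0 < h := h0
  have hdiff : ‖hF'.toLp F' - hF.toLp F‖ ≤ |C| * h := by
    rw [← MemLp.toLp_sub, Lp.norm_toLp]
    refine (ENNReal.toReal_le_of_le_ofReal (b := |C| * h) (by positivity) (hle.trans ?_))
    exact ENNReal.ofReal_le_ofReal (by gcongr; exact le_abs_self C)
  have hF'n : ‖hF'.toLp F'‖ ≤ D := by
    have : hF'.toLp F' = hF.toLp F + (hF'.toLp F' - hF.toLp F) := by abel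
    rw [this]
    refine (norm_add_le _ _).trans ?_
    rw [hD]
    gcongr
    nlinarith [abs_nonneg C]
  have hnorm : ‖X + h • compLaw X (hF'.toLp F') - X‖ ≤ h * D := by
    rw [add_sub_cancel_left, norm_smul, LinearIsometry.norm_map, Real.norm_of_nonneg hpos.le]
    gcongr
  have key := hψ (X + h • compLaw X (hF'.toLp F')) (hnorm.trans_lt h1)
  rw [law_add_smul_compLaw X hF' h] at key
  have hsq : c * ‖X + h • compLaw X (hF'.toLp F') - X‖ ^ 2 ≤ |c| * (h * D) ^ 2 := by
    gcongr
    exact le_abs_self c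
  have hinner : inner ℝ p (X + h • compLaw X (hF'.toLp F') - X) =
      h * inner ℝ p (compLaw X (hF'.toLp F')) := by
    rw [add_sub_cancel_left, real_inner_smul_right]
  have hin2 : inner ℝ p (compLaw X (hF.toLp F)) - ‖p‖ * (|C| * h) ≤
      inner ℝ p (compLaw X (hF'.toLp F')) := by
    have e1 : inner ℝ p (compLaw X (hF.toLp F)) - inner ℝ p (compLaw X (hF'.toLp F')) =
        inner ℝ p (compLaw X (hF.toLp F - hF'.toLp F')) := by
      rw [map_sub, inner_sub_right]
    have e2 : inner ℝ p (compLaw X (hF.toLp F - hF'.toLp F')) ≤ ‖p‖ * (|C| * h) :=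
      inner_le_of_norm_le le_rfl (by rw [LinearIsometry.norm_map, norm_sub_rev]; exact hdiff)
    linarith
  rw [hpair F hF]
  rw [hinner] at key
  have hfin : h * (inner ℝ p (compLaw X (hF.toLp F)) - ‖p‖ * (|C| * h)) ≤
      h * inner ℝ p (compLaw X (hF'.toLp F')) := by gcongr
  have hA2 : h * (h * A) ≤ h * ε := by gcongr
  rw [hA] at hA2
  linarith

end Lift

/-! ### The lifted control system -/

section Field

variable {d : ℕ} {U : Type*} {Ω : Type*} [MeasurableSpace Ω] {μ : Measure Ω}
  {f : E d → P2 d → U → E d} {L : ℝ}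

lemma field_lipschitz (hlip : ∀ (x₁ x₂ : E d) (m₁ m₂ : P2 d) (u : U),
      ‖f x₁ m₁ u - f x₂ m₂ u‖ ≤ L * (‖x₁ - x₂‖ + W2 m₁ m₂)) (x y : E d) (m : P2 d) (u : U) :
    ‖f x m u - f y m u‖ ≤ L * ‖x - y‖ := by
  simpa [W2_self] using hlip x y m m u

lemma field_norm_le (hlip : ∀ (x₁ x₂ : E d) (m₁ m₂ : P2 d) (u : U),
      ‖f x₁ m₁ u - f x₂ m₂ u‖ ≤ L * (‖x₁ - x₂‖ + W2 m₁ m₂)) (x : E d) (m : P2 d) (u : U) :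
    ‖f x m u‖ ≤ ‖f 0 m u‖ + L * ‖x‖ := by
  have h := field_lipschitz hlip x 0 m u
  rw [sub_zero] at h
  linarith [norm_le_norm_add_norm_sub' (f x m u) (f 0 m u)]

lemma memLp_field [IsFiniteMeasure μ] (hL : 0 ≤ L)
    (hlip : ∀ (x₁ x₂ : E d) (m₁ m₂ : P2 d) (u : U),
      ‖f x₁ m₁ u - f x₂ m₂ u‖ ≤ L * (‖x₁ - x₂‖ + W2 m₁ m₂)) (m : P2 d) (u : U) {X : Ω → E d}
    (hX : MemLp X 2 μ) : MemLp (fun ω => f (X ω) m u) 2 μ := by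
  have hcont : Continuous fun x => f x m u :=
    (LipschitzWith.of_dist_le_mul (K := L.toNNReal) fun x y => by
      rw [Real.coe_toNNReal _ hL, dist_eq_norm, dist_eq_norm]
      exact field_lipschitz hlip x y m u).continuous
  have hb : MemLp (fun ω => ‖f 0 m u‖ + L * ‖X ω‖) 2 μ :=
    (memLp_const ‖f 0 m u‖).add (hX.norm.const_mul L)
  exact hb.mono' (hcont.comp_aestronglyMeasurable hX.aestronglyMeasurable)
    (Eventually.of_forall fun ω => field_norm_le hlip (X ω) m u)

variable [IsProbabilityMeasure μ]

/-- The lift of the velocity field to random variables. -/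
noncomputable def liftField (hL : 0 ≤ L) (hlip : ∀ (x₁ x₂ : E d) (m₁ m₂ : P2 d) (u : U),
      ‖f x₁ m₁ u - f x₂ m₂ u‖ ≤ L * (‖x₁ - x₂‖ + W2 m₁ m₂)) (X : Lp (E d) 2 μ) (u : U) :
    Lp (E d) 2 μ :=
  (memLp_field hL hlip (law X) u (Lp.memLp X)).toLp _

lemma liftField_lipschitz (hL : 0 ≤ L) (hlip : ∀ (x₁ x₂ : E d) (m₁ m₂ : P2 d) (u : U),
      ‖f x₁ m₁ u - f x₂ m₂ u‖ ≤ L * (‖x₁ - x₂‖ + W2 m₁ m₂)) (X Y : Lp (E d) 2 μ) (u : U) :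
    ‖liftField hL hlip X u - liftField hL hlip Y u‖ ≤ 2 * L * ‖X - Y‖ := by
  -- V moves the state but not the law. The remaining difference, in the law alone, is bounded
  -- uniformly by L‖X − Y‖, which on a probability space bounds its L² norm as well.
  let V : Lp (E d) 2 μ := (memLp_field hL hlip (law X) u (Lp.memLp Y)).toLp _
  have h1 : ‖liftField hL hlip X u - V‖ ≤ L * ‖X - Y‖ := by
    refine Lp.norm_le_mul_norm_of_ae_le_mul ?_
    filter_upwards [Lp.coeFn_sub (liftField hL hlip X u) V, Lp.coeFn_sub X Y,
      (memLp_field hL hlip (law X) u (Lp.memLp X)).coeFn_toLp,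
      (memLp_field hL hlip (law X) u (Lp.memLp Y)).coeFn_toLp] with ω e1 e2 e3 e4
    rw [e1, e2, Pi.sub_apply, Pi.sub_apply, liftField, e3, e4]
    exact field_lipschitz hlip _ _ _ _
  have h2 : ‖V - liftField hL hlip Y u‖ ≤ L * ‖X - Y‖ := by
    have h := Lp.norm_le_of_ae_bound (f := V - liftField hL hlip Y u) (C := L * ‖X - Y‖)
      (by positivity) ?_
    · have hμ : measureUnivNNReal μ = 1 := by simp [measureUnivNNReal]
      simpa [hμ] using h
    · filter_upwards [Lp.coeFn_sub V (liftField hL hlip Y u),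
        (memLp_field hL hlip (law Y) u (Lp.memLp Y)).coeFn_toLp,
        (memLp_field hL hlip (law X) u (Lp.memLp Y)).coeFn_toLp] with ω e1 e3 e4
      rw [e1, Pi.sub_apply, liftField, e3, e4]
      refine (hlip _ _ _ _ _).trans ?_
      rw [sub_self, norm_zero, zero_add]
      gcongr
      exact W2_law_le X Y
  calc _ = ‖(liftField hL hlip X u - V) + (V - liftField hL hlip Y u)‖ := by congr 1; abel
    _ ≤ _ := norm_add_le _ _
    _ ≤ _ := by linarith

/-- Dominated convergence: compactness of U bounds f(0, law X, u), and linear growth in x gives a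
square integrable majorant. -/
lemma continuous_liftField_right [MetricSpace U] [CompactSpace U]
    (hf : Continuous fun p : E d × P2 d × U => f p.1 p.2.1 p.2.2) (hL : 0 ≤ L)
    (hlip : ∀ (x₁ x₂ : E d) (m₁ m₂ : P2 d) (u : U),
      ‖f x₁ m₁ u - f x₂ m₂ u‖ ≤ L * (‖x₁ - x₂‖ + W2 m₁ m₂)) (X : Lp (E d) 2 μ) :
    Continuous fun u => liftField hL hlip X u := by
  have hfu : ∀ x, Continuous fun u => f x (law X) u := fun x =>
    hf.comp (by fun_prop : Continuous fun u : U => (x, law X, u))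
  obtain ⟨c, hc⟩ := (isCompact_range (hfu 0).norm).bddAbove
  have hbound : ∀ x u, ‖f x (law X) u‖ ≤ c + L * ‖x‖ := fun x u =>
    (field_norm_le hlip x (law X) u).trans (by gcongr; exact hc (mem_range_self u))
  have hmem : ∀ u, MemLp (fun ω => f (X ω) (law X) u) 2 μ := fun u =>
    memLp_field hL hlip (law X) u (Lp.memLp X)
  have hG : MemLp (fun ω => 2 * (c + L * ‖X ω‖)) 2 μ :=
    ((memLp_const c).add ((Lp.memLp X).norm.const_mul L)).const_mul 2
  have hGfin : ∫⁻ ω, ENNReal.ofReal (2 * (c + L * ‖X ω‖)) ^ 2 ∂μ ≠ ∞ := by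
    have h := eLpNorm_nnreal_pow_eq_lintegral (f := fun ω => 2 * (c + L * ‖X ω‖)) (μ := μ)
      (p := 2) two_ne_zero
    simp only [NNReal.coe_ofNat, ENNReal.rpow_ofNat, ENNReal.coe_ofNat] at h
    have h2 : ∫⁻ ω, ‖2 * (c + L * ‖X ω‖)‖ₑ ^ 2 ∂μ ≠ ∞ := by
      rw [← h]; exact ENNReal.pow_ne_top hG.eLpNorm_ne_top
    refine ne_top_of_le_ne_top h2 (lintegral_mono fun ω => ?_)
    gcongr
    rw [← ofReal_norm]
    exact ENNReal.ofReal_le_ofReal (le_abs_self _)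
  refine continuous_iff_continuousAt.2 fun u₀ => ?_
  refine tendsto_iff_edist_tendsto_0.2 ?_
  have hed : ∀ u, edist (liftField hL hlip X u) (liftField hL hlip X u₀) ^ 2 =
      ∫⁻ ω, edist (f (X ω) (law X) u) (f (X ω) (law X) u₀) ^ 2 ∂μ := by
    intro u
    rw [edist_dist, dist_eq_norm, ← ENNReal.ofReal_pow (norm_nonneg _), ← lintegral_edist_sq_eq]
    refine lintegral_congr_ae ?_
    filter_upwards [(hmem u).coeFn_toLp, (hmem u₀).coeFn_toLp] with ω e1 e2
    rw [liftField, liftField, e1, e2]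
  have hlim : Tendsto (fun u => edist (liftField hL hlip X u) (liftField hL hlip X u₀) ^ 2)
      (𝓝 u₀) (𝓝 0) := by
    simp only [hed]
    have h0 : (0 : ℝ≥0∞) = ∫⁻ ω, 0 ∂μ := by simp
    rw [h0]
    refine tendsto_lintegral_filter_of_dominated_convergence'
      (fun ω => ENNReal.ofReal (2 * (c + L * ‖X ω‖)) ^ 2) ?_ ?_ hGfin ?_
    · refine Eventually.of_forall fun u => ?_
      exact ((hmem u).aestronglyMeasurable.edist (hmem u₀).aestronglyMeasurable).pow_const 2
    · refine Eventually.of_forall fun u => Eventually.of_forall fun ω => ?_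
      rw [edist_dist]
      gcongr
      rw [dist_eq_norm]
      linarith [norm_sub_le (f (X ω) (law X) u) (f (X ω) (law X) u₀), hbound (X ω) u,
        hbound (X ω) u₀]
    · refine Eventually.of_forall fun ω => ?_
      have h1 := tendsto_iff_edist_tendsto_0.1 ((hfu (X ω)).tendsto u₀)
      simpa [Function.comp_def] using ((ENNReal.continuous_pow 2).tendsto 0).comp h1
  have hsqrt := hlim.ennrpow_const (1 / 2)
  rw [ENNReal.zero_rpow_of_pos (by norm_num)] at hsqrt
  refine hsqrt.congr fun u => ?_
  rw [← ENNReal.rpow_natCast, ← ENNReal.rpow_mul]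
  norm_num

lemma continuous_liftField [MetricSpace U] [CompactSpace U]
    (hf : Continuous fun p : E d × P2 d × U => f p.1 p.2.1 p.2.2) (hL : 0 ≤ L)
    (hlip : ∀ (x₁ x₂ : E d) (m₁ m₂ : P2 d) (u : U),
      ‖f x₁ m₁ u - f x₂ m₂ u‖ ≤ L * (‖x₁ - x₂‖ + W2 m₁ m₂)) :
    Continuous fun q : Lp (E d) 2 μ × U => liftField hL hlip q.1 q.2 := by
  refine continuous_prod_of_continuous_lipschitzWith
    (fun q : Lp (E d) 2 μ × U => liftField hL hlip q.1 q.2) (2 * L).toNNReal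
    (fun X => continuous_liftField_right hf hL hlip X) fun u => ?_
  refine LipschitzWith.of_dist_le_mul fun X Y => ?_
  rw [Real.coe_toNNReal _ (by positivity), dist_eq_norm, dist_eq_norm]
  exact liftField_lipschitz hL hlip X Y u

/-- The lifted velocity lies in the range of `compLaw X`, where p and its projection s pair
identically. -/
lemma hamiltonian_law (hL : 0 ≤ L) (hlip : ∀ (x₁ x₂ : E d) (m₁ m₂ : P2 d) (u : U),
      ‖f x₁ m₁ u - f x₂ m₂ u‖ ≤ L * (‖x₁ - x₂‖ + W2 m₁ m₂)) (X p : Lp (E d) 2 μ)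
    {s : E d → E d} (hpair : ∀ (F : E d → E d) (hF : MemLp F 2 (law X).toMeasure),
      pairing (law X) s F = inner ℝ p (compLaw X (hF.toLp F))) :
    hamiltonian f (law X) s = ⨅ u, inner ℝ p (liftField hL hlip X u) := by
  refine iInf_congr fun u => ?_
  exact hpair _ (memLp_field hL hlip (law X) u (law X).memLp_id)

end Field

/-! ### Comparison and uniqueness -/

section Main

variable {d : ℕ} {U : Type*} {f : E d → P2 d → U → E d} {L : ℝ} {G : Set (P2 d)} {κ : DiffKind}
  {Ω : Type*} [MeasurableSpace Ω] {μ : Measure Ω} [IsProbabilityMeasure μ]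

lemma exists_ball_subset_preimage_law (hG : IsOpen G) {X : Lp (E d) 2 μ} (hX : law X ∈ G) :
    ∃ r > 0, ∀ X' : Lp (E d) 2 μ, ‖X' - X‖ < r → law X' ∈ closure G := by
  obtain ⟨r, hr, h⟩ := Metric.isOpen_iff.1 (hG.preimage continuous_law) X hX
  exact ⟨r, hr, fun X' hX' => subset_closure (h (by rwa [Metric.mem_ball, dist_eq_norm]))⟩

lemma mem_of_mem_closure_of_notMem_frontier (hG : IsOpen G) {m : P2 d} (h : m ∈ closure G)
    (h' : m ∉ frontier G) : m ∈ G := by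
  by_contra hm
  exact h' (by rw [hG.frontier_eq]; exact ⟨h, hm⟩)

lemma WassersteinHJ.IsViscositySupersolution.proximal_ineq [Nonempty U] {φ : P2 d → ℝ}
    (hφ : IsViscositySupersolution κ f G φ) (hG : IsOpen G) (hL : 0 ≤ L)
    (hlip : ∀ (x₁ x₂ : E d) (m₁ m₂ : P2 d) (u : U),
      ‖f x₁ m₁ u - f x₂ m₂ u‖ ≤ L * (‖x₁ - x₂‖ + W2 m₁ m₂)) {X : Lp (E d) 2 μ}
    (hX : law X ∈ G) {p : Lp (E d) 2 μ} {c : ℝ}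
    (hp : ∀ X' : Lp (E d) 2 μ, law X' ∈ closure G →
      φ (law X) + inner ℝ p (X' - X) - c * ‖X' - X‖ ^ 2 ≤ φ (law X')) {e : ℝ} (he : 0 < e) :
    ∃ u, inner ℝ p (liftField hL hlip X u) + 1 - φ (law X) ≤ e := by
  obtain ⟨s, hs, hpair⟩ := exists_field_of_lp X p
  obtain ⟨r, hr, hball⟩ := exists_ball_subset_preimage_law hG hX
  have hsub := mem_subdifferential_of_proximal κ hr (fun X' hX' => hp X' (hball X' hX')) hs hpair
  have h := hφ.ineq _ hX s hsub
  rw [hamiltonian_law hL hlip X p hpair] at h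
  obtain ⟨u, hu⟩ := exists_lt_of_ciInf_lt
    (show (⨅ u, inner ℝ p (liftField hL hlip X u)) < φ (law X) - 1 + e by linarith)
  exact ⟨u, by linarith⟩

lemma WassersteinHJ.IsViscositySubsolution.proximal_ineq [MetricSpace U] [CompactSpace U]
    {φ : P2 d → ℝ}
    (hφ : IsViscositySubsolution κ f G φ) (hG : IsOpen G)
    (hf : Continuous fun p : E d × P2 d × U => f p.1 p.2.1 p.2.2) (hL : 0 ≤ L)
    (hlip : ∀ (x₁ x₂ : E d) (m₁ m₂ : P2 d) (u : U),
      ‖f x₁ m₁ u - f x₂ m₂ u‖ ≤ L * (‖x₁ - x₂‖ + W2 m₁ m₂)) {X : Lp (E d) 2 μ}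
    (hX : law X ∈ G) {p : Lp (E d) 2 μ} {c : ℝ}
    (hp : ∀ X' : Lp (E d) 2 μ, law X' ∈ closure G →
      φ (law X') ≤ φ (law X) + inner ℝ p (X' - X) + c * ‖X' - X‖ ^ 2) (u : U) :
    0 ≤ inner ℝ p (liftField hL hlip X u) + 1 - φ (law X) := by
  obtain ⟨s, hs, hpair⟩ := exists_field_of_lp X p
  obtain ⟨r, hr, hball⟩ := exists_ball_subset_preimage_law hG hX
  have hneg : -s ∈ subdifferential κ (fun m => -φ m) (law X) := by
    refine mem_subdifferential_of_proximal κ (p := -p) (c := c) hr (fun X' hX' => ?_) hs.neg ?_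
    · rw [inner_neg_left]
      linarith [hp X' (hball X' hX')]
    · intro F hF
      rw [inner_neg_left, ← hpair F hF]
      simp [pairing, integral_neg]
  have h := hφ.ineq _ hX s (mem_superdifferential_of_neg hneg)
  rw [hamiltonian_law hL hlip X p hpair] at h
  -- Needed because a real infimum over an unbounded family takes the default value 0; compactness
  -- of U excludes this.
  have hbdd : BddBelow (range fun u => inner ℝ p (liftField hL hlip X u)) :=
    (isCompact_range (continuous_const.inner
      (continuous_liftField_right hf hL hlip X))).bddBelow
  linarith [ciInf_le hbdd u]

/-- A viscosity supersolution is nonnegative. -/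
lemma WassersteinHJ.IsViscositySupersolution.nonneg [MetricSpace U] [CompactSpace U] [Nonempty U]
    {φ : P2 d → ℝ}
    (hφ : IsViscositySupersolution κ f G φ) (hG : IsOpen G)
    (hf : Continuous fun p : E d × P2 d × U => f p.1 p.2.1 p.2.2) (hL : 0 ≤ L)
    (hlip : ∀ (x₁ x₂ : E d) (m₁ m₂ : P2 d) (u : U),
      ‖f x₁ m₁ u - f x₂ m₂ u‖ ≤ L * (‖x₁ - x₂‖ + W2 m₁ m₂)) {m : P2 d}
    (hm : m ∈ closure G) : 0 ≤ φ m := by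
  obtain ⟨C, hC⟩ := hφ.bounded
  rw [← law_idLp m] at hm ⊢
  -- Zero is a subsolution on the whole space. With S₂ = `univ` it has no boundary, so B₂ = ∅ and
  -- the condition that would require nonnegativity of φ is vacuous.
  refine proximal_comparison (continuous_liftField hf hL hlip) (by positivity)
    (liftField_lipschitz hL hlip) (S₁ := law ⁻¹' closure G) (S₂ := univ)
    (B₁ := law ⁻¹' frontier G) (B₂ := ∅) (φ₁ := fun X => φ (law X)) (φ₂ := fun _ => 0) (C := C)
    (isClosed_closure.preimage continuous_law) isClosed_univ
    (isClosed_frontier.preimage continuous_law)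
    (hφ.lsc.comp continuous_law.continuousOn fun X hX => hX) upperSemicontinuousOn_const
    (fun X hX => hC _ hX) (fun X _ => ?_) (fun X hX => hφ.boundary _ hX) (fun _ _ _ => le_rfl)
    (fun _ _ y hy => absurd hy (notMem_empty y)) ?_ ?_ hm (mem_univ _)
  · rw [abs_zero]
    exact (abs_nonneg _).trans (hC _ hm)
  · intro X hX hXB p c hp e he
    exact hφ.proximal_ineq hG hL hlip (mem_of_mem_closure_of_notMem_frontier hG hX hXB) hp he
  · intro Y _ _ p c hp u
    -- A constant has only the zero proximal supergradient, as seen by testing at Y − h p.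
    have hp0 : p = 0 := by
      have h : 0 ≤ -‖p‖ ^ 2 := by
        refine nonneg_of_forall_pos_mul_add_sq (B := c * ‖p‖ ^ 2) fun h hh => ?_
        have := hp (Y - h • p) (mem_univ _)
        rw [sub_sub_cancel_left, inner_neg_right, real_inner_smul_right,
          real_inner_self_eq_norm_sq, norm_neg, norm_smul, mul_pow, Real.norm_eq_abs,
          sq_abs] at this
        linarith
      have : ‖p‖ ^ 2 = 0 := le_antisymm (by linarith) (sq_nonneg _)
      simpa using this
    rw [hp0, inner_zero_left]
    norm_num

/-- Comparison of viscosity sub- and supersolutions of the Dirichlet problem. -/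
theorem viscosity_comparison [MetricSpace U] [CompactSpace U] [Nonempty U]
    {φ₁ φ₂ : P2 d → ℝ}
    (h₁ : IsViscositySupersolution κ f G φ₁)
    (h₂ : IsViscositySubsolution κ f G φ₂) (hG : IsOpen G)
    (hf : Continuous fun p : E d × P2 d × U => f p.1 p.2.1 p.2.2) (hL : 0 ≤ L)
    (hlip : ∀ (x₁ x₂ : E d) (m₁ m₂ : P2 d) (u : U),
      ‖f x₁ m₁ u - f x₂ m₂ u‖ ≤ L * (‖x₁ - x₂‖ + W2 m₁ m₂)) {m : P2 d}
    (hm : m ∈ closure G) : φ₂ m ≤ φ₁ m := by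
  obtain ⟨C₁, hC₁⟩ := h₁.bounded
  obtain ⟨C₂, hC₂⟩ := h₂.bounded
  -- Fixes the probability space as (ℝ^d, m) and the starting point as the identity. The lifted
  -- functions see only laws of random variables on this space, which the dynamics never leaves.
  rw [← law_idLp m] at hm ⊢
  refine proximal_comparison (continuous_liftField hf hL hlip) (by positivity)
    (liftField_lipschitz hL hlip) (S₁ := law ⁻¹' closure G) (S₂ := law ⁻¹' closure G)
    (B₁ := law ⁻¹' frontier G) (B₂ := law ⁻¹' frontier G) (φ₁ := fun X => φ₁ (law X))
    (φ₂ := fun X => φ₂ (law X)) (C := max C₁ C₂)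
    (isClosed_closure.preimage continuous_law) (isClosed_closure.preimage continuous_law)
    (isClosed_frontier.preimage continuous_law)
    (h₁.lsc.comp continuous_law.continuousOn fun X hX => hX)
    (h₂.usc.comp continuous_law.continuousOn fun X hX => hX)
    (fun X hX => (hC₁ _ hX).trans (le_max_left _ _))
    (fun X hX => (hC₂ _ hX).trans (le_max_right _ _)) (fun X hX => h₁.boundary _ hX)
    (fun X hX _ => (h₂.boundary _ hX).le) (fun X hX Y hY => ?_) ?_ ?_ hm hm
  · simp only
    rw [h₂.boundary _ hY]
    exact h₁.nonneg hG hf hL hlip hX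
  · intro X hX hXB p c hp e he
    exact h₁.proximal_ineq hG hL hlip (mem_of_mem_closure_of_notMem_frontier hG hX hXB) hp he
  · intro Y hY hYB p c hp u
    exact h₂.proximal_ineq hG hf hL hlip (mem_of_mem_closure_of_notMem_frontier hG hY hYB) hp u

lemma viscositySolution_le [MetricSpace U] [CompactSpace U] [Nonempty U]
    {φ φ' : P2 d → ℝ} (h : IsViscositySolution κ f G φ)
    (h' : IsViscositySolution κ f G φ') (hG : IsOpen G)
    (hf : Continuous fun p : E d × P2 d × U => f p.1 p.2.1 p.2.2) (hL : 0 ≤ L)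
    (hlip : ∀ (x₁ x₂ : E d) (m₁ m₂ : P2 d) (u : U),
      ‖f x₁ m₁ u - f x₂ m₂ u‖ ≤ L * (‖x₁ - x₂‖ + W2 m₁ m₂)) {m : P2 d}
    (hm : m ∈ closure G) : φ m ≤ φ' m := by
  by_cases hmG : m ∈ frontier G
  · rw [h.supersolution.boundary m hmG, h'.supersolution.boundary m hmG]
  · obtain ⟨φs, hsub, hlim⟩ := h.approx
    -- The approximants are only known to be bounded, each with its own bound, so comparison is
    -- needed beyond functions with values in [0,1].
    exact le_of_tendsto' (hlim m (mem_of_mem_closure_of_notMem_frontier hG hm hmG)) fun k =>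
      viscosity_comparison h'.supersolution (hsub k) hG hf hL hlip hm

end Main

theorem mainTheorem2 {d : ℕ} {U : Type*} [MetricSpace U] [CompactSpace U] [Nonempty U]
    (f : E d → P2 d → U → E d)
    (hf_cont : Continuous (fun p : E d × P2 d × U => f p.1 p.2.1 p.2.2))
    (hf_lip : ∃ L : ℝ, 0 < L ∧ ∀ (x₁ x₂ : E d) (m₁ m₂ : P2 d) (u : U),
      ‖f x₁ m₁ u - f x₂ m₂ u‖ ≤ L * (‖x₁ - x₂‖ + W2 m₁ m₂))
    (M : Set (P2 d)) (hM : IsClosed M) (κ : DiffKind) :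
    (∀ φ₁ φ₂ : P2 d → ℝ,
      IsViscositySupersolution κ f Mᶜ φ₁ → IsViscositySubsolution κ f Mᶜ φ₂ →
      (∀ m ∈ closure Mᶜ, φ₁ m ∈ Set.Icc (0 : ℝ) 1) →
      (∀ m ∈ closure Mᶜ, φ₂ m ∈ Set.Icc (0 : ℝ) 1) →
      ∀ m ∈ closure Mᶜ, φ₂ m ≤ φ₁ m) ∧
    (∀ φ φ' : P2 d → ℝ,
      IsViscositySolution κ f Mᶜ φ → IsViscositySolution κ f Mᶜ φ' →
      Set.EqOn φ φ' (closure Mᶜ)) := by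
  obtain ⟨L, hL, hlip⟩ := hf_lip
  have hG : IsOpen Mᶜ := hM.isOpen_compl
  refine ⟨fun φ₁ φ₂ h₁ h₂ _ _ m hm => ?_, fun φ φ' h h' m hm => ?_⟩
  · exact viscosity_comparison h₁ h₂ hG hf_cont hL.le hlip hm
  · exact le_antisymm (viscositySolution_le h h' hG hf_cont hL.le hlip hm)
      (viscositySolution_le h' h hG hf_cont hL.le hlip hm)
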